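/- Let $d\ge 2$, and let $f:V_2\to V_1$ be a polynomial-like map of degree $d$: $V_1,V_2\subset\mathbb{C}$ are simply connected domains, $\overline{V_2}$ is a compact subset of $V_1$, and $f$ is a proper holomorphic map of degree $d$. Assume that the filled Julia set $K(f)=\{z\in V_2 : f^{n}(z)\in V_2 \text{ for all } n\ge 0\}$ is connected. Let $\phi:V_1\setminus K(f)\to V_1\setminus K(f)$ be an orientation-preserving homeomorphism that commutes with $f$, that is, $\phi(V_2\setminus K(f))\subset V_2$ and $\phi\circ f=f\circ\phi$ on $V_2\setminus K(f)$. Let $\chi$ be any straightening of $f$: a homeomorphism from a neighbourhood of $K(f)$ onto a neighbourhood of the filled Julia set $K(P)$ of a monic polynomial $P$ of degree $d$, with $\chi(K(f))=K(P)$ and $\chi\circ f=P\circ\chi$ near $K(f)$ (for example a hybrid conjugacy). Let $B:\mathbb{C}\setminus K(P)\to\{|w|>1\}$ be the Böttcher coordinate of $P$, i.e. the conformal isomorphism with $B\circ P=B^{d}$ and $B(z)/z\to1$ as $z\to\infty$. For $\theta\in\mathbb{R}$, the rotation of angle $\theta$ near $K(f)$ is the map $z\mapsto \chi^{-1}\bigl(B^{-1}(e^{i\theta}B(\chi(z)))\bigr)$,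 defined for those $z\notin K(f)$ in the domain of $\chi$ for which $B^{-1}(e^{i\theta}B(\chi(z)))$ lies in the image of $\chi$. Then there is $j\in\{0,\dots,d-2\}$ such that, for the rotation $\rho_j$ of angle $2\pi j/(d-1)$, the composition $\rho_j\circ\phi$ is defined at all points outside $K(f)$ sufficiently close to $K(f)$, and it extends continuously to $K(f)$ by the identity map of $K(f)$. -/

import Mathlib

open Set Filter Topology

namespace PolyLike

/-- `f : V₂ → V₁` is a polynomial-like map of degree `d`: a proper holomorphic map of degree `d`
between simply connected planar domains with `V₂` compactly contained in `V₁`.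
(The values of `f` outside `V₂` play no role.) -/
structure IsPolynomialLike (d : ℕ) (V₂ V₁ : Set ℂ) (f : ℂ → ℂ) : Prop where
  isOpen_dom : IsOpen V₂
  isOpen_cod : IsOpen V₁
  simplyConnected_dom : IsSimplyConnected V₂
  simplyConnected_cod : IsSimplyConnected V₁
  isCompact_closure : IsCompact (closure V₂)
  closure_subset : closure V₂ ⊆ V₁
  mapsTo : MapsTo f V₂ V₁
  holomorphic : DifferentiableOn ℂ f V₂
  proper : ∀ C : Set ℂ, C ⊆ V₁ → IsCompact C → IsCompact (V₂ ∩ f ⁻¹' C)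
  /-- every point has exactly `d` preimages, counted with multiplicity -/
  degree : ∀ w ∈ V₁,
    ∑ᶠ z ∈ {z : ℂ | z ∈ V₂ ∧ f z = w}, analyticOrderNatAt (fun x => f x - w) z = d

/-- The filled Julia set of a polynomial-like map `f : V₂ → V₁`: the points whose whole forward
orbit stays in `V₂`. -/
def filledJulia (V₂ : Set ℂ) (f : ℂ → ℂ) : Set ℂ :=
  {z | ∀ n : ℕ, f^[n] z ∈ V₂}

/-- The filled Julia set of a polynomial: the complement of the basin of infinity. -/
def polyFilledJulia (P : Polynomial ℂ) : Set ℂ :=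
  {z | ¬ Tendsto (fun n : ℕ => (fun x => P.eval x)^[n] z) atTop (cocompact ℂ)}

/-- `B` is the Böttcher coordinate of the monic polynomial `P` with connected filled Julia set:
the conformal isomorphism of the basin of infinity onto the complement of the closed unit disk
that conjugates `P` to `w ↦ w ^ deg P` and is tangent to the identity at infinity. -/
structure IsBottcher (P : Polynomial ℂ) (B : OpenPartialHomeomorph ℂ ℂ) : Prop where
  source_eq : B.source = (polyFilledJulia P)ᶜ
  target_eq : B.target = {w : ℂ | 1 < ‖w‖}
  holomorphic : DifferentiableOn ℂ B B.source
  semiconj : ∀ z ∈ B.source, B (P.eval z) = B z ^ P.natDegree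
  tangent : Tendsto (fun z => B z / z) (cocompact ℂ) (𝓝 1)

/-- `χ` is a straightening of the degree `d` polynomial-like map `f` on `V₂`: a homeomorphism from
a neighbourhood of the filled Julia set of `f` onto a neighbourhood of the filled Julia set of a
monic polynomial `P` of degree `d`, mapping one filled Julia set onto the other and conjugating
`f` to `P`. Every hybrid conjugacy between `f` and `P` is of this kind; quasi-conformality and
`∂̄χ = 0` on the filled Julia set are not demanded. -/
structure IsStraightening (d : ℕ) (V₂ : Set ℂ) (f : ℂ → ℂ) (P : Polynomial ℂ)
    (χ : OpenPartialHomeomorph ℂ ℂ) : Prop where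
  monic : P.Monic
  natDegree_eq : P.natDegree = d
  subset_source : filledJulia V₂ f ⊆ χ.source
  image_eq : χ '' filledJulia V₂ f = polyFilledJulia P
  conj : ∀ z ∈ χ.source, z ∈ V₂ → f z ∈ χ.source → χ (f z) = P.eval (χ z)

/-- The rotation of angle `θ` on the basin of infinity of a polynomial with Böttcher
coordinate `B`. -/
noncomputable def bottcherRotation (B : OpenPartialHomeomorph ℂ ℂ) (θ : ℝ) (w : ℂ) : ℂ :=
  B.symm (Complex.exp (θ * Complex.I) * B w)

/-- The points outside the filled Julia set `K` at which the rotation of angle `θ`, transported by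
the straightening `χ`, is defined. -/
def rotationDomain (K : Set ℂ) (χ B : OpenPartialHomeomorph ℂ ℂ) (θ : ℝ) : Set ℂ :=
  {z | z ∈ χ.source \ K ∧ bottcherRotation B θ (χ z) ∈ χ.target}

/-- The rotation of angle `θ` near the filled Julia set of a polynomial-like map, transported by
the straightening `χ`. -/
noncomputable def rotation (χ B : OpenPartialHomeomorph ℂ ℂ) (θ : ℝ) (z : ℂ) : ℂ :=
  χ.symm (bottcherRotation B θ (χ z))

/-- A homeomorphism `φ` between open subsets of the plane preserves orientation: for every closed
disk in its domain, the image of the positively oriented boundary circle winds exactly once, in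
the positive direction, around the image of the centre. The winding number is read off from a
continuous logarithm `L`. -/
def OrientationPreserving (φ : OpenPartialHomeomorph ℂ ℂ) : Prop :=
  ∀ (z₀ : ℂ) (r : ℝ), 0 < r → Metric.closedBall z₀ r ⊆ φ.source →
    ∃ L : ℝ → ℂ, Continuous L ∧
      (∀ t : ℝ, Complex.exp (L t) = φ (circleMap z₀ r t) - φ z₀) ∧
      L (2 * Real.pi) - L 0 = 2 * Real.pi * Complex.I

open Classical in
/-- The map `ψ`, defined on `D` (a subset of the complement of `K`), extends to `K` as the
identity: `D ∪ K` is a neighbourhood of `K`, and the map that equals `ψ` on `D` and the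
identity on `K` is continuous on `D ∪ K`. -/
def ExtendsAsIdentity (K D : Set ℂ) (ψ : ℂ → ℂ) : Prop :=
  D ∪ K ∈ 𝓝ˢ K ∧ ContinuousOn (fun z => if z ∈ K then z else ψ z) (D ∪ K)

end PolyLike

/-! Let `Ψ = B ∘ χ`, which identifies the points outside `K = K(f)` close to `K` with an annulus
`1 < ‖w‖ < R` and turns `f` into `w ↦ w ^ d`. In this chart `φ` becomes a map `Φ` commuting with
`w ↦ w ^ d`. Since `K` is connected and `φ` is a homeomorphism preserving orientation, `Φ` has
degree `1` on circles, so `Φ w = w * exp (L w)` with `L` continuous and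
`L (w ^ d) = d * L w + 2πi n` for some integer `n`. For `j ≡ n` modulo `d - 1`, the rotation of
angle `2πj / (d - 1)` replaces `L` by `D = L + 2πi n / (d - 1)`, which satisfies
`D (w ^ d) = d * D w`. As `log ‖w ^ d‖ = d * log ‖w‖`, bounds on a compact fundamental annulus
spread to `‖D w‖ ≤ C * log ‖w‖` up to the unit circle: in logarithmic coordinates, the rotated map
moves points by a bounded hyperbolic distance. By Harnack's inequality such a displacement becomes
a Euclidean displacement tending to `0` at `K` once it is carried to the plane by the conformal
map `B.symm`, and this persists under the homeomorphism `χ.symm`.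
-/

namespace PolyLike

theorem exists_continuousOn_exp_eq {E : Type*} [NormedAddCommGroup E] [NormedSpace ℝ E]
    {U : Set E} (hU : Convex ℝ U) (hUo : IsOpen U) {F : E → ℂ} (hF : ContinuousOn F U)
    (h0 : ∀ z ∈ U, F z ≠ 0) :
    ∃ L : E → ℂ, ContinuousOn L U ∧ ∀ z ∈ U, Complex.exp (L z) = F z := by
  rcases U.eq_empty_or_nonempty with rfl | hne
  · exact ⟨fun _ => 0, by simp, by simp⟩
  have hsc : IsSimplyConnected U :=
    have := hU.contractibleSpace hne
    inferInstanceAs (SimplyConnectedSpace U)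
  obtain ⟨L, hL, hexp⟩ := Complex.exists_continuousOn_eqOn_exp_comp hsc hUo hF
    (by rintro ⟨z, hz, hz0⟩; exact h0 z hz hz0)
  exact ⟨L, hL, fun z hz => hexp hz⟩

theorem exists_int_of_exp_eq {X : Type*} [TopologicalSpace X] {S : Set X} (hS : IsPreconnected S)
    {L L' : X → ℂ} (hL : ContinuousOn L S) (hL' : ContinuousOn L' S)
    (h : ∀ x ∈ S, Complex.exp (L x) = Complex.exp (L' x)) :
    ∃ n : ℤ, ∀ x ∈ S, L x = L' x + n * (2 * Real.pi * Complex.I) := by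
  rcases S.eq_empty_or_nonempty with rfl | ⟨x₀, hx₀⟩
  · exact ⟨0, by simp⟩
  choose! n hn using fun x hx => Complex.exp_eq_exp_iff_exists_int.1 (h x hx)
  have hre : ∀ y ∈ S, ((L y - L' y) / (2 * Real.pi * Complex.I)).re = n y := fun y hy => by
    rw [hn y hy, add_sub_cancel_left, mul_div_cancel_right₀ _ Complex.two_pi_I_ne_zero,
      Complex.intCast_re]
  have hdiscrete : IsDiscrete (range ((↑) : ℤ → ℝ)) :=
    ⟨Int.isClosedEmbedding_coe_real.isEmbedding.toHomeomorph.symm.isEmbedding.discreteTopology⟩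
  refine ⟨n x₀, fun x hx => ?_⟩
  have hconst := hS.constant_of_mapsTo hdiscrete
    (Complex.continuous_re.comp_continuousOn ((hL.sub hL').div_const _))
    (fun y hy => ⟨n y, (hre y hy).symm⟩) hx hx₀
  have hnx : (n x : ℝ) = n x₀ := (hre x hx).symm.trans (hconst.trans (hre x₀ hx₀))
  rw [hn x hx, Int.cast_injective hnx]

theorem continuousOn_of_comp_exp {Y : Type*} [TopologicalSpace Y] {S : Set ℂ} (hS : IsOpen S)
    (h0 : (0 : ℂ) ∉ S) {L : ℂ → Y} (hL : ContinuousOn (L ∘ Complex.exp) (Complex.exp ⁻¹' S)) :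
    ContinuousOn L S := by
  intro w hw
  have hexp : Complex.exp (Complex.log w) = w := Complex.exp_log (ne_of_mem_of_not_mem hw h0)
  have hcont : ContinuousAt (L ∘ Complex.exp) (Complex.log w) :=
    hL.continuousAt ((hS.preimage Complex.continuous_exp).mem_nhds (by rwa [mem_preimage, hexp]))
  refine ContinuousAt.continuousWithinAt ?_
  rw [ContinuousAt, ← hexp, ← (Complex.hasStrictDerivAt_exp _).map_nhds_eq (Complex.exp_ne_zero _)]
  exact tendsto_map'_iff.2 hcont

/-- The open round annulus centred at the origin with radii `a < b`; the disk punctured at the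
origin is `annulus 0 b`. -/
def annulus (a b : ℝ) : Set ℂ := {w | a < ‖w‖ ∧ ‖w‖ < b}

theorem isOpen_annulus (a b : ℝ) : IsOpen (annulus a b) :=
  (isOpen_lt continuous_const continuous_norm).inter (isOpen_lt continuous_norm continuous_const)

theorem annulus_subset_annulus {a a' b b' : ℝ} (ha : a' ≤ a) (hb : b ≤ b') :
    annulus a b ⊆ annulus a' b' := fun _ hw => ⟨ha.trans_lt hw.1, hw.2.trans_le hb⟩

theorem sphere_subset_annulus {a b x : ℝ} (ha : a < x) (hb : x < b) :
    Metric.sphere 0 x ⊆ annulus a b := fun w hw => by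
  rw [mem_sphere_zero_iff_norm] at hw
  exact ⟨hw ▸ ha, hw ▸ hb⟩

theorem zero_notMem_annulus {a b : ℝ} (ha : 0 ≤ a) : (0 : ℂ) ∉ annulus a b := fun h =>
  (norm_zero (E := ℂ) ▸ h.1).not_ge ha

theorem ofReal_mem_annulus {a b t : ℝ} (ha : 0 ≤ a) (ht : t ∈ Ioo a b) : (t : ℂ) ∈ annulus a b := by
  have hnorm : ‖(t : ℂ)‖ = t := Complex.norm_of_nonneg (ha.trans ht.1.le)
  exact ⟨ht.1.trans_eq hnorm.symm, hnorm.trans_lt ht.2⟩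

theorem convex_exp_preimage_annulus (a b : ℝ) : Convex ℝ (Complex.exp ⁻¹' annulus a b) := by
  have heq : Complex.exp ⁻¹' annulus a b = Complex.reLm ⁻¹' (Real.exp ⁻¹' Ioo a b) := by
    ext s
    simp only [annulus, mem_preimage, mem_ofPred_eq, Complex.norm_exp, mem_Ioo, Complex.reLm_coe]
  rw [heq]
  exact (ordConnected_Ioo.preimage_mono Real.exp_monotone).convex.linear_preimage _

theorem isPreconnected_annulus {a : ℝ} (ha : 0 ≤ a) (b : ℝ) : IsPreconnected (annulus a b) := by
  have himage : Complex.exp '' (Complex.exp ⁻¹' annulus a b) = annulus a b := by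
    refine image_preimage_eq_of_subset fun w hw => ?_
    rw [Complex.range_exp]
    exact ne_of_mem_of_not_mem hw (zero_notMem_annulus ha)
  rw [← himage]
  exact (convex_exp_preimage_annulus a b).isPreconnected.image _ Complex.continuous_exp.continuousOn

/-- `F` has degree `n` on the subset `S` of the punctured plane: it equals `w ^ n` times a function
with a continuous logarithm. If `S` is an annulus or a circle around the origin, this says that `F`
does not vanish on `S` and that the image of a positively oriented circle in `S` winds `n` times
around the origin. -/
def HasDegree (S : Set ℂ) (F : ℂ → ℂ) (n : ℤ) : Prop :=
  ∃ L : ℂ → ℂ, ContinuousOn L S ∧ ∀ w ∈ S, F w = w ^ n * Complex.exp (L w)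

theorem hasDegree_const (S : Set ℂ) {c : ℂ} (hc : c ≠ 0) : HasDegree S (fun _ => c) 0 :=
  ⟨fun _ => Complex.log c, continuousOn_const, fun w _ => by
    rw [zpow_zero, one_mul, Complex.exp_log hc]⟩

theorem hasDegree_id (S : Set ℂ) : HasDegree S (fun w => w) 1 :=
  ⟨fun _ => 0, continuousOn_const, fun w _ => by rw [zpow_one, Complex.exp_zero, mul_one]⟩

namespace HasDegree

variable {S T : Set ℂ} {F G : ℂ → ℂ} {m n : ℤ}

theorem mono (h : HasDegree S F n) (hTS : T ⊆ S) : HasDegree T F n :=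
  let ⟨L, hL, hF⟩ := h
  ⟨L, hL.mono hTS, fun w hw => hF w (hTS hw)⟩

theorem congr (h : HasDegree S F n) (hFG : EqOn G F S) : HasDegree S G n :=
  let ⟨L, hL, hF⟩ := h
  ⟨L, hL, fun w hw => (hFG hw).trans (hF w hw)⟩

theorem ne_zero (h : HasDegree S F n) (h0 : (0 : ℂ) ∉ S) : ∀ w ∈ S, F w ≠ 0 := by
  obtain ⟨L, -, hF⟩ := h
  intro w hw
  rw [hF w hw]
  exact mul_ne_zero (zpow_ne_zero _ (ne_of_mem_of_not_mem hw h0)) (Complex.exp_ne_zero _)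

theorem continuousOn (h : HasDegree S F n) (h0 : (0 : ℂ) ∉ S) : ContinuousOn F S := by
  obtain ⟨L, hL, hF⟩ := h
  exact ((continuousOn_id.zpow₀ n fun w hw => Or.inl (ne_of_mem_of_not_mem hw h0)).mul
    hL.cexp).congr hF

theorem mul (hF : HasDegree S F m) (hG : HasDegree S G n) (h0 : (0 : ℂ) ∉ S) :
    HasDegree S (fun w => F w * G w) (m + n) := by
  obtain ⟨L, hL, hF⟩ := hF
  obtain ⟨M, hM, hG⟩ := hG
  refine ⟨fun w => L w + M w, hL.add hM, fun w hw => ?_⟩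
  simp only [hF w hw, hG w hw, zpow_add₀ (ne_of_mem_of_not_mem hw h0), Complex.exp_add]
  ring

theorem zpow (hF : HasDegree S F m) (n : ℤ) : HasDegree S (fun w => F w ^ n) (m * n) := by
  obtain ⟨L, hL, hF⟩ := hF
  refine ⟨fun w => n * L w, continuousOn_const.mul hL, fun w hw => ?_⟩
  simp only [hF w hw, mul_zpow, zpow_mul, Complex.exp_int_mul]

theorem comp (hF : HasDegree T F n) (hG : HasDegree S G m) (h0 : (0 : ℂ) ∉ S) (hST : MapsTo G S T) :
    HasDegree S (F ∘ G) (m * n) := by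
  have hGc := hG.continuousOn h0
  obtain ⟨L, hL, hF⟩ := hF
  have hexp : HasDegree S (fun w => Complex.exp (L (G w))) 0 :=
    ⟨L ∘ G, hL.comp hGc hST, fun w _ => by rw [zpow_zero, one_mul, Function.comp_apply]⟩
  exact add_zero (m * n) ▸ ((hG.zpow n).mul hexp h0).congr fun w hw => hF (G w) (hST hw)

/-- Rouché: `G / F` takes its values in the disk of radius `1` around `1`, where the principal
logarithm is continuous. -/
theorem of_norm_sub_lt (hF : HasDegree S F n) (h0 : (0 : ℂ) ∉ S) (hG : ContinuousOn G S)
    (hlt : ∀ w ∈ S, ‖G w - F w‖ < ‖F w‖) : HasDegree S G n := by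
  have hF0 := hF.ne_zero h0
  have hslit : ∀ w ∈ S, G w / F w ∈ Complex.slitPlane := fun w hw => by
    have h1 : ‖(G w - F w) / F w‖ < 1 := by
      rw [norm_div, div_lt_one (norm_pos_iff.2 (hF0 w hw))]
      exact hlt w hw
    rw [sub_div, div_self (hF0 w hw)] at h1
    simpa only [add_sub_cancel] using Complex.mem_slitPlane_of_norm_lt_one h1
  have hquot : HasDegree S (fun w => G w / F w) 0 :=
    ⟨fun w => Complex.log (G w / F w), (hG.div (hF.continuousOn h0) hF0).clog hslit, fun w hw => by
      rw [zpow_zero, one_mul, Complex.exp_log (Complex.slitPlane_ne_zero (hslit w hw))]⟩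
  refine add_zero n ▸ (hF.mul hquot h0).congr fun w hw => ?_
  exact (mul_div_cancel₀ _ (hF0 w hw)).symm

end HasDegree

theorem exists_hasDegree_annulus {a b : ℝ} (ha : 0 ≤ a) {F : ℂ → ℂ}
    (hF : ContinuousOn F (annulus a b)) (h0 : ∀ w ∈ annulus a b, F w ≠ 0) :
    ∃ n, HasDegree (annulus a b) F n := by
  set T := Complex.exp ⁻¹' annulus a b with hT
  have hconv : Convex ℝ T := convex_exp_preimage_annulus a b
  have hshift : ∀ s, s + 2 * Real.pi * Complex.I ∈ T ↔ s ∈ T := fun s => by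
    rw [hT, mem_preimage, mem_preimage, Complex.exp_periodic s]
  obtain ⟨M, hM, hMF⟩ := exists_continuousOn_exp_eq hconv
    ((isOpen_annulus a b).preimage Complex.continuous_exp)
    (hF.comp Complex.continuous_exp.continuousOn fun s hs => hs) fun s hs => h0 _ hs
  obtain ⟨n, hn⟩ : ∃ n : ℤ, ∀ s ∈ T, M (s + 2 * Real.pi * Complex.I) = M s + n * _ :=
    exists_int_of_exp_eq hconv.isPreconnected
      (hM.comp (by fun_prop) fun s hs => (hshift s).2 hs) hM fun s hs => by
        simp only [Function.comp_apply, hMF s hs, hMF _ ((hshift s).2 hs), Complex.exp_periodic s]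
  set N : ℂ → ℂ := T.indicator fun s => M s - n * s with hN
  have hNper : Function.Periodic N (2 * Real.pi * Complex.I) := fun s => by
    by_cases hs : s ∈ T
    · rw [hN, indicator_of_mem hs, indicator_of_mem ((hshift s).2 hs)]
      linear_combination hn s hs
    · rw [hN, indicator_of_notMem hs, indicator_of_notMem (mt (hshift s).1 hs)]
  have hNlog : ∀ s, N (Complex.log (Complex.exp s)) = N s := fun s => by
    obtain ⟨k, hk⟩ := Complex.log_exp_exists s
    rw [hk]
    exact hNper.int_mul k s
  have hNT : EqOn N (fun s => M s - n * s) T := fun s hs => indicator_of_mem hs _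
  refine ⟨n, N ∘ Complex.log, continuousOn_of_comp_exp (isOpen_annulus a b)
    (zero_notMem_annulus ha) ?_, fun w hw => ?_⟩
  · exact (hM.sub (by fun_prop)).congr fun s hs => (hNlog s).trans (hNT hs)
  · have hexp := Complex.exp_log (ne_of_mem_of_not_mem hw (zero_notMem_annulus ha))
    have hlog : Complex.log w ∈ T := by rwa [hT, mem_preimage, hexp]
    rw [Function.comp_apply, hNT hlog, Complex.exp_sub, hMF _ hlog, Complex.exp_int_mul,
      Function.comp_apply, hexp, mul_div_cancel₀ _ (zpow_ne_zero _ (hexp ▸ Complex.exp_ne_zero _))]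

section Circle

variable {x : ℝ} {κ F : ℂ → ℂ} {m n : ℤ}

theorem zero_notMem_sphere (hx : 0 < x) : (0 : ℂ) ∉ Metric.sphere (0 : ℂ) x := fun h =>
  hx.ne (by simpa only [mem_sphere_zero_iff_norm, norm_zero] using h)

theorem exists_hasDegree_sphere (hx : 0 < x) (hF : ContinuousOn F (Metric.sphere 0 x))
    (h0 : ∀ w ∈ Metric.sphere (0 : ℂ) x, F w ≠ 0) : ∃ n, HasDegree (Metric.sphere 0 x) F n := by
  set p : ℂ → ℂ := fun w => (x / ‖w‖ : ℝ) • w with hp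
  have hne : ∀ w ∈ annulus 0 (x + 1), ‖w‖ ≠ 0 := fun w hw => hw.1.ne'
  have hpS : ∀ w ∈ annulus 0 (x + 1), p w ∈ Metric.sphere (0 : ℂ) x := fun w hw => by
    rw [mem_sphere_zero_iff_norm, hp, norm_smul, Real.norm_of_nonneg (by positivity),
      div_mul_cancel₀ _ (hne w hw)]
  have hpc : ContinuousOn p (annulus 0 (x + 1)) :=
    (continuousOn_const.div continuous_norm.continuousOn hne).smul continuousOn_id
  obtain ⟨n, hn⟩ := exists_hasDegree_annulus le_rfl (hF.comp hpc hpS) fun w hw => h0 _ (hpS w hw)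
  refine ⟨n, (hn.mono (sphere_subset_annulus hx (lt_add_one x))).congr fun w hw => ?_⟩
  rw [mem_sphere_zero_iff_norm] at hw
  simp only [Function.comp_apply, hp, hw, div_self hx.ne', one_smul]

theorem HasDegree.exp_lift_sub (h : HasDegree (Metric.sphere 0 x) F n) (hx : 0 < x) {L : ℝ → ℂ}
    (hL : Continuous L) (hLF : ∀ t, Complex.exp (L t) = F (circleMap 0 x t)) :
    L (2 * Real.pi) - L 0 = n * (2 * Real.pi * Complex.I) := by
  obtain ⟨M, hM, hMF⟩ := h
  have hcircle : ∀ t, circleMap 0 x t ∈ Metric.sphere (0 : ℂ) x := circleMap_mem_sphere 0 hx.le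
  obtain ⟨k, hk⟩ := exists_int_of_exp_eq isPreconnected_univ hL.continuousOn
    (L' := fun t : ℝ => n * (Real.log x + t * Complex.I) + M (circleMap 0 x t))
    (Continuous.add (by fun_prop)
      (hM.comp_continuous (continuous_circleMap 0 x) hcircle)).continuousOn fun t _ => by
      rw [hLF, hMF _ (hcircle t), Complex.exp_add, Complex.exp_int_mul, Complex.exp_add,
        ← Complex.ofReal_exp, Real.exp_log hx, circleMap_zero]
  have hperiod : circleMap 0 x (2 * Real.pi) = circleMap 0 x 0 := by
    simpa only [zero_add] using periodic_circleMap 0 x 0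
  rw [hk _ trivial, hk _ trivial, hperiod]
  push_cast
  ring

theorem HasDegree.unique (hm : HasDegree (Metric.sphere 0 x) F m)
    (hn : HasDegree (Metric.sphere 0 x) F n) (hx : 0 < x) : m = n := by
  have hcircle : ∀ t, circleMap 0 x t ∈ Metric.sphere (0 : ℂ) x := circleMap_mem_sphere 0 hx.le
  have h0 := zero_notMem_sphere hx
  obtain ⟨L, hL, hLF⟩ := exists_continuousOn_exp_eq convex_univ isOpen_univ
    ((hn.continuousOn h0).comp_continuous (continuous_circleMap 0 x) hcircle).continuousOn
    fun t _ => hn.ne_zero h0 _ (hcircle t)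
  rw [continuousOn_univ] at hL
  have hmn := (hm.exp_lift_sub hx hL fun t => hLF t trivial).symm.trans
    (hn.exp_lift_sub hx hL fun t => hLF t trivial)
  exact_mod_cast mul_right_cancel₀ Complex.two_pi_I_ne_zero hmn

theorem isOpen_setOf_hasDegree_sub (hx : 0 < x) (hκ : ContinuousOn κ (Metric.sphere 0 x)) (n : ℤ) :
    IsOpen {q | HasDegree (Metric.sphere 0 x) (fun w => κ w - q) n} := by
  have h0 := zero_notMem_sphere hx
  refine Metric.isOpen_iff.2 fun q hq => ?_
  have hclosed := ((isCompact_sphere (0 : ℂ) x).image_of_continuousOn hκ).isClosed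
  obtain ⟨r, hr, hball⟩ := Metric.isOpen_iff.1 hclosed.isOpen_compl q (by
    rintro ⟨w, hw, rfl⟩
    exact hq.ne_zero h0 w hw (sub_self _))
  refine ⟨r, hr, fun q' hq' => hq.of_norm_sub_lt h0 (hκ.sub continuousOn_const) fun w hw => ?_⟩
  rw [sub_sub_sub_cancel_left, norm_sub_rev, ← dist_eq_norm, ← dist_eq_norm]
  exact (Metric.mem_ball.1 hq').trans_le <| not_lt.1 fun hlt => hball hlt (mem_image_of_mem κ hw)

theorem HasDegree.of_isPreconnected {X : Set ℂ} {p q : ℂ}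
    (h : HasDegree (Metric.sphere 0 x) (fun w => κ w - p) n) (hx : 0 < x)
    (hκ : ContinuousOn κ (Metric.sphere 0 x)) (hX : IsPreconnected X)
    (hdisj : Disjoint (κ '' Metric.sphere 0 x) X) (hp : p ∈ X) (hq : q ∈ X) :
    HasDegree (Metric.sphere 0 x) (fun w => κ w - q) n := by
  refine hX.subset_left_of_subset_union
    (u := {q | HasDegree (Metric.sphere 0 x) (fun w => κ w - q) n})
    (v := ⋃ m ∈ {m : ℤ | m ≠ n}, {q | HasDegree (Metric.sphere 0 x) (fun w => κ w - q) m})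
    (isOpen_setOf_hasDegree_sub hx hκ n)
    (isOpen_biUnion fun m _ => isOpen_setOf_hasDegree_sub hx hκ m) ?_ (fun c hc => ?_)
    ⟨p, hp, h⟩ hq
  · simp only [disjoint_left, mem_iUnion, not_exists]
    exact fun c hn m hmn hm => hmn (hm.unique hn hx)
  · obtain ⟨m, hm⟩ := exists_hasDegree_sphere (F := fun w => κ w - c) hx
      (hκ.sub continuousOn_const) fun w hw h0 =>
        disjoint_left.1 hdisj (mem_image_of_mem κ hw) (sub_eq_zero.1 h0 ▸ hc)
    by_cases hmn : m = n
    · exact Or.inl (hmn ▸ hm)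
    · exact Or.inr (mem_biUnion hmn hm)

theorem hasDegree_sub_of_norm_lt (hx : 0 < x) {q : ℂ} (hκ : ContinuousOn κ (Metric.sphere 0 x))
    (hlt : ∀ w ∈ Metric.sphere (0 : ℂ) x, ‖κ w‖ < ‖q‖) :
    HasDegree (Metric.sphere 0 x) (fun w => κ w - q) 0 := by
  have hq : -q ≠ 0 := fun h => (norm_nonneg (κ x)).not_gt <| by
    simpa only [neg_eq_zero.1 h, norm_zero] using hlt x (by simp [hx.le])
  refine (hasDegree_const _ hq).of_norm_sub_lt (zero_notMem_sphere hx)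
    (hκ.sub continuousOn_const) fun w hw => ?_
  rw [sub_neg_eq_add, sub_add_cancel, norm_neg]
  exact hlt w hw

/-- If `n ≠ 0`, the points `q` outside `C` around which the loop winds `0` times form a nontrivial
clopen subset of the plane. -/
theorem eq_zero_of_forall_mem_diff_hasDegree (hx : 0 < x) (hκ : ContinuousOn κ (Metric.sphere 0 x))
    {C O : Set ℂ} (hC : IsCompact C) (hκC : κ '' Metric.sphere 0 x ⊆ C) (hO : IsOpen O)
    (hCO : C ⊆ O) (hn : ∀ q ∈ O \ C, HasDegree (Metric.sphere 0 x) (fun w => κ w - q) n) :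
    n = 0 := by
  by_contra hn0
  set U : ℤ → Set ℂ := fun m => {q | HasDegree (Metric.sphere 0 x) (fun w => κ w - q) m}
  have hUopen : ∀ m, IsOpen (U m) := isOpen_setOf_hasDegree_sub hx hκ
  have hcompl : (U 0 \ C)ᶜ = O ∪ ⋃ m ∈ {m : ℤ | m ≠ 0}, U m := by
    refine Subset.antisymm (fun q hq => or_iff_not_imp_left.2 fun hqO => ?_)
      (union_subset (fun q hqO hq => ?_) (iUnion₂_subset fun m hm q hqm hq => ?_))
    · obtain ⟨m, hm⟩ : ∃ m, q ∈ U m := exists_hasDegree_sphere hx (hκ.sub continuousOn_const)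
        fun w hw hw0 => hqO (hCO (hκC (sub_eq_zero.1 hw0 ▸ mem_image_of_mem κ hw)))
      exact mem_biUnion (fun h0 => hq ⟨h0 ▸ hm, fun hqC => hqO (hCO hqC)⟩) hm
    · exact hn0 ((hn q ⟨hqO, hq.2⟩).unique hq.1 hx)
    · exact hm (HasDegree.unique hqm hq.1 hx)
  have hclopen : IsClopen (U 0 \ C) :=
    ⟨⟨hcompl ▸ hO.union (isOpen_biUnion fun m _ => hUopen m)⟩, (hUopen 0).sdiff hC.isClosed⟩
  obtain ⟨M, hM⟩ := hC.isBounded.exists_norm_le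
  have hMx : κ x ∈ C := hκC (mem_image_of_mem κ (by simp [hx.le]))
  have hM1 : ‖((M + 1 : ℝ) : ℂ)‖ = M + 1 :=
    Complex.norm_of_nonneg (add_nonneg ((norm_nonneg _).trans (hM _ hMx)) zero_le_one)
  have hfar : ((M + 1 : ℝ) : ℂ) ∈ U 0 \ C := by
    refine ⟨hasDegree_sub_of_norm_lt hx hκ fun w hw => ?_, fun hmem => ?_⟩
    · linarith [hM _ (hκC (mem_image_of_mem κ hw))]
    · linarith [hM _ hmem]
  have huniv := (isClopen_iff.1 hclopen).resolve_left (nonempty_of_mem hfar).ne_empty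
  exact (huniv.symm ▸ mem_univ (κ x) : κ x ∈ U 0 \ C).2 hMx

end Circle

/-- `F` maps small positively oriented circles around `z₀` to loops that wind `n` times around
`F z₀`; in particular `F` does not take the value `F z₀` at other points near `z₀`. -/
def HasLocalDegree (F : ℂ → ℂ) (z₀ : ℂ) (n : ℤ) : Prop :=
  ∃ r > 0, HasDegree (annulus 0 r) (fun δ => F (z₀ + δ) - F z₀) n

theorem add_mem_of_mem_annulus {z δ : ℂ} {r : ℝ} (hδ : δ ∈ annulus 0 r) :
    z + δ ∈ Metric.ball z r := by
  rw [mem_ball_iff_norm, add_sub_cancel_left]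
  exact hδ.2

theorem HasLocalDegree.unique {F : ℂ → ℂ} {z₀ : ℂ} {m n : ℤ} (hm : HasLocalDegree F z₀ m)
    (hn : HasLocalDegree F z₀ n) : m = n := by
  obtain ⟨r, hr, hm⟩ := hm
  obtain ⟨s, hs, hn⟩ := hn
  obtain ⟨x, hx, hxrs⟩ := exists_between (lt_min hr hs)
  rw [lt_min_iff] at hxrs
  exact (hm.mono (sphere_subset_annulus hx hxrs.1)).unique
    (hn.mono (sphere_subset_annulus hx hxrs.2)) hx

theorem HasLocalDegree.congr {F G : ℂ → ℂ} {z₀ : ℂ} {n : ℤ} (h : HasLocalDegree F z₀ n)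
    (hFG : G =ᶠ[𝓝 z₀] F) : HasLocalDegree G z₀ n := by
  obtain ⟨r, hr, h⟩ := h
  obtain ⟨s, hs, hball⟩ := Metric.eventually_nhds_iff_ball.1 hFG
  refine ⟨min r s, lt_min hr hs, (h.mono (annulus_subset_annulus le_rfl (min_le_left r s))).congr
    fun δ hδ => ?_⟩
  have hmem : z₀ + δ ∈ Metric.ball z₀ s :=
    add_mem_of_mem_annulus (annulus_subset_annulus le_rfl (min_le_right r s) hδ)
  exact congrArg₂ _ (hball _ hmem) hFG.self_of_nhds

theorem hasLocalDegree_id (z₀ : ℂ) : HasLocalDegree id z₀ 1 :=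
  ⟨1, one_pos, (hasDegree_id _).congr fun _ _ => add_sub_cancel_left _ _⟩

theorem HasLocalDegree.comp {F γ : ℂ → ℂ} {z₀ : ℂ} {m n : ℤ} (hF : HasLocalDegree F (γ z₀) n)
    (hγ : HasLocalDegree γ z₀ m) (hγc : ContinuousAt γ z₀) :
    HasLocalDegree (F ∘ γ) z₀ (m * n) := by
  obtain ⟨r, hr, hF⟩ := hF
  obtain ⟨s, hs, hγ⟩ := hγ
  obtain ⟨t, ht, hball⟩ := Metric.continuousAt_iff.1 hγc r hr
  have h0 : (0 : ℂ) ∉ annulus 0 (min s t) := zero_notMem_annulus le_rfl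
  have hγs := hγ.mono (annulus_subset_annulus le_rfl (min_le_left s t))
  refine ⟨min s t, lt_min hs ht, (hF.comp hγs h0 fun δ hδ => ?_).congr fun δ _ => ?_⟩
  · refine ⟨norm_pos_iff.2 (hγs.ne_zero h0 δ hδ), ?_⟩
    rw [← dist_eq_norm]
    exact hball (add_mem_of_mem_annulus (annulus_subset_annulus le_rfl (min_le_right s t) hδ))
  · simp only [Function.comp_apply, add_sub_cancel]

theorem exists_hasLocalDegree (e : OpenPartialHomeomorph ℂ ℂ) {z₀ : ℂ} (hz₀ : z₀ ∈ e.source) :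
    ∃ n, HasLocalDegree e z₀ n := by
  obtain ⟨r, hr, hball⟩ := Metric.isOpen_iff.1 e.open_source z₀ hz₀
  have hmem : ∀ δ ∈ annulus 0 r, z₀ + δ ∈ e.source := fun δ hδ => hball (add_mem_of_mem_annulus hδ)
  obtain ⟨n, hn⟩ := exists_hasDegree_annulus le_rfl
    ((e.continuousOn.comp (by fun_prop) hmem).sub continuousOn_const) fun δ hδ hzero => by
      have heq := e.injOn (hmem δ hδ) hz₀ (sub_eq_zero.1 hzero)
      exact zero_notMem_annulus le_rfl (add_eq_left.1 heq ▸ hδ)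
  exact ⟨n, r, hr, hn⟩

theorem HasLocalDegree.ne_zero {e : OpenPartialHomeomorph ℂ ℂ} {z₀ : ℂ} {n : ℤ}
    (h : HasLocalDegree e z₀ n) (hz₀ : z₀ ∈ e.source) : n ≠ 0 := by
  obtain ⟨m, hm⟩ := exists_hasLocalDegree e.symm (e.map_source hz₀)
  have hid := (hm.comp h (e.continuousAt hz₀)).congr (G := id) <| by
    filter_upwards [e.eventually_left_inverse hz₀] with z hz using hz.symm
  rintro rfl
  exact zero_ne_one ((zero_mul m).symm.trans (hid.unique (hasLocalDegree_id z₀)))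

theorem OrientationPreserving.hasLocalDegree {φ : OpenPartialHomeomorph ℂ ℂ}
    (hφ : OrientationPreserving φ) {z₀ : ℂ} (hz₀ : z₀ ∈ φ.source) : HasLocalDegree φ z₀ 1 := by
  obtain ⟨n, hn⟩ := exists_hasLocalDegree φ hz₀
  suffices n = 1 by rwa [this] at hn
  obtain ⟨r, hr, hnr⟩ := hn
  obtain ⟨s, hs, hball⟩ := Metric.isOpen_iff.1 φ.open_source z₀ hz₀
  obtain ⟨x, hx, hxrs⟩ := exists_between (lt_min hr hs)
  rw [lt_min_iff] at hxrs
  obtain ⟨L, hL, hexp, hinc⟩ := hφ z₀ x hx ((Metric.closedBall_subset_ball hxrs.2).trans hball)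
  have hn1 := (hnr.mono (sphere_subset_annulus hx hxrs.1)).exp_lift_sub hx hL fun t => by
    rw [hexp, circleMap, circleMap, zero_add]
  exact_mod_cast mul_right_cancel₀ Complex.two_pi_I_ne_zero
    (hn1.symm.trans (hinc.trans (one_mul _).symm))

section ArgumentPrinciple

variable {U : Set ℂ} {F : ℂ → ℂ} {w₀ : ℂ} {ε : ℤ}

open Classical in
/-- On a small circle around `w₀` the quotient `F w / (w - w₀) ^ ε` has a continuous logarithm;
extending the logarithm to the disk removes the zero. -/
theorem exists_continuousOn_eq_div_zpow (hF : ContinuousOn F U) (hw₀ : w₀ ∈ U)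
    (hzero : ∀ w ∈ U, F w = 0 ↔ w = w₀) (hε : HasLocalDegree F w₀ ε) {t : ℝ} (ht : 0 < t) :
    ∃ G : ℂ → ℂ, ContinuousOn G U ∧ (∀ w ∈ U, G w ≠ 0) ∧
      ∀ w, t ≤ ‖w - w₀‖ → G w = F w / (w - w₀) ^ ε := by
  obtain ⟨r, hr, L, hL, hLF⟩ := hε
  obtain ⟨s, hs, hsrt⟩ := exists_between (lt_min hr ht)
  rw [lt_min_iff] at hsrt
  have hmaps : MapsTo (fun w => w - w₀) (Metric.sphere w₀ s) (annulus 0 r) := fun w hw => by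
    rw [mem_sphere_iff_norm] at hw
    exact ⟨hw ▸ hs, hw ▸ hsrt.1⟩
  obtain ⟨g, hg⟩ := ContinuousMap.exists_restrict_eq (Metric.isClosed_sphere (x := w₀) (ε := s))
    ⟨_, continuousOn_iff_continuous_domRestrict.1 (hL.comp (by fun_prop) hmaps)⟩
  have hsphere : ∀ w ∈ Metric.sphere w₀ s, Complex.exp (g w) = F w / (w - w₀) ^ ε := by
    intro w hw
    have hgw : g w = L (w - w₀) := DFunLike.congr_fun hg ⟨w, hw⟩
    have hFw := hLF _ (hmaps hw)
    simp only [add_sub_cancel, (hzero w₀ hw₀).2 rfl, sub_zero] at hFw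
    rw [hFw, hgw, mul_div_cancel_left₀ _ (zpow_ne_zero _ (norm_pos_iff.1 (hmaps hw).1))]
  have hoff : ∀ w, s ≤ ‖w - w₀‖ → w - w₀ ≠ 0 := fun w hw => norm_pos_iff.1 (hs.trans_le hw)
  refine ⟨(Metric.ball w₀ s).piecewise (fun w => Complex.exp (g w)) fun w => F w / (w - w₀) ^ ε,
    ContinuousOn.piecewise ?_ (by fun_prop) ?_, fun w hw => ?_, fun w hw => ?_⟩
  · exact fun w hw => hsphere w (frontier_ball w₀ hs.ne' ▸ hw.2)
  · rw [Metric.isOpen_ball.isClosed_compl.closure_eq]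
    have hne : ∀ w ∈ U ∩ (Metric.ball w₀ s)ᶜ, w - w₀ ≠ 0 := fun w hw =>
      hoff w (not_lt.1 fun h => hw.2 (mem_ball_iff_norm.2 h))
    exact (hF.mono inter_subset_left).div
      (ContinuousOn.zpow₀ (by fun_prop) _ fun w hw => Or.inl (hne w hw))
      fun w hw => zpow_ne_zero _ (hne w hw)
  · by_cases hball : w ∈ Metric.ball w₀ s
    · rw [piecewise_eq_of_mem _ _ _ hball]
      exact Complex.exp_ne_zero _
    · rw [piecewise_eq_of_notMem _ _ _ hball]
      have hne := hoff w (not_lt.1 fun h => hball (mem_ball_iff_norm.2 h))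
      exact div_ne_zero (mt (hzero w hw).1 (sub_ne_zero.1 hne)) (zpow_ne_zero _ hne)
  · exact piecewise_eq_of_notMem _ _ _ fun hball =>
      (mem_ball_iff_norm.1 hball).not_ge (hsrt.2.le.trans hw)

theorem hasDegree_sub_sphere_of_norm_lt {x : ℝ} (hx : ‖w₀‖ < x) :
    HasDegree (Metric.sphere 0 x) (fun w => w - w₀) 1 := by
  refine (hasDegree_id _).of_norm_sub_lt (zero_notMem_sphere ((norm_nonneg _).trans_lt hx))
    (by fun_prop) fun w hw => ?_
  rwa [sub_sub_cancel_left, norm_neg, mem_sphere_zero_iff_norm.1 hw]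

theorem HasDegree.eq_add_of_hasLocalDegree {a b x y : ℝ} {m n : ℤ} (ha : 0 ≤ a)
    (hF : ContinuousOn F (annulus a b)) (hw₀ : w₀ ∈ annulus a b)
    (hzero : ∀ w ∈ annulus a b, F w = 0 ↔ w = w₀) (hε : HasLocalDegree F w₀ ε)
    (hax : a < x) (hx : x < ‖w₀‖) (hy : ‖w₀‖ < y) (hyb : y < b)
    (hm : HasDegree (Metric.sphere 0 x) F m) (hn : HasDegree (Metric.sphere 0 y) F n) :
    n = m + ε := by
  obtain ⟨t, ht, htxy⟩ := exists_between (lt_min (sub_pos.2 hx) (sub_pos.2 hy))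
  rw [lt_min_iff] at htxy
  obtain ⟨G, hG, hG0, hGF⟩ :=
    exists_continuousOn_eq_div_zpow hF hw₀ hzero hε ht
  obtain ⟨k, hk⟩ := exists_hasDegree_annulus ha hG hG0
  have hmul : ∀ z {l : ℤ}, a < z → z < b → t ≤ |z - ‖w₀‖| →
      HasDegree (Metric.sphere 0 z) (fun w => w - w₀) l →
      HasDegree (Metric.sphere 0 z) F (k + l * ε) := by
    intro z l hz hzb htz hl
    refine ((hk.mono (sphere_subset_annulus hz hzb)).mul (hl.zpow ε)
      (zero_notMem_sphere (ha.trans_lt hz))).congr fun w hw => ?_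
    have hwt : t ≤ ‖w - w₀‖ :=
      htz.trans (mem_sphere_zero_iff_norm.1 hw ▸ abs_norm_sub_norm_le w w₀)
    simp only [hGF w hwt]
    rw [div_mul_cancel₀ _ (zpow_ne_zero _ (norm_pos_iff.1 (ht.trans_le hwt)))]
  have hinner := hmul x hax (by linarith) (by rw [abs_of_nonpos] <;> linarith)
    (hasDegree_sub_of_norm_lt (ha.trans_lt hax) continuousOn_id fun w hw => by
      rwa [mem_sphere_zero_iff_norm.1 hw])
  have houter := hmul y (by linarith) hyb (by rw [abs_of_nonneg] <;> linarith)
    (hasDegree_sub_sphere_of_norm_lt hy)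
  rw [hn.unique houter (by linarith), hm.unique hinner (by linarith)]
  ring

end ArgumentPrinciple

/-- The filter of points tending to the unit circle from outside. -/
noncomputable def nhdsOuter : Filter ℂ := comap norm (𝓝[>] 1)

theorem hasBasis_nhdsOuter : nhdsOuter.HasBasis (fun y : ℝ => 1 < y) (annulus 1) :=
  (nhdsGT_basis (1 : ℝ)).comap norm

theorem eventually_mem_annulus {y : ℝ} (hy : 1 < y) : ∀ᶠ w in nhdsOuter, w ∈ annulus 1 y :=
  hasBasis_nhdsOuter.mem_of_mem hy

instance : nhdsOuter.NeBot := by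
  refine hasBasis_nhdsOuter.neBot_iff.2 fun {y} hy => ?_
  obtain ⟨t, ht⟩ := exists_between hy
  exact ⟨t, ofReal_mem_annulus zero_le_one ht⟩

/-- `κ` is a collar of the planar set `K`: an injective parametrization, by the annulus
`1 < ‖w‖ < R`, of a punctured neighbourhood of `K`, the inner boundary circle corresponding
to `K`. -/
structure IsCollar (K : Set ℂ) (R : ℝ) (κ : ℂ → ℂ) : Prop where
  continuousOn : ContinuousOn κ (annulus 1 R)
  injOn : InjOn κ (annulus 1 R)
  notMem : ∀ w ∈ annulus 1 R, κ w ∉ K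
  tendsto : Tendsto κ nhdsOuter (𝓝ˢ K)
  isOpen_union : ∀ x ∈ Ioo 1 R, IsOpen (K ∪ κ '' annulus 1 x)

theorem isCompact_union_image {K : Set ℂ} {x : ℝ} {κ : ℂ → ℂ} (hK : IsCompact K)
    (hκ : ContinuousOn κ {w | ‖w‖ ∈ Ioc 1 x}) (hlim : Tendsto κ nhdsOuter (𝓝ˢ K)) :
    IsCompact (K ∪ κ '' {w | ‖w‖ ∈ Ioc 1 x}) := by
  refine isCompact_of_finite_subcover fun {ι} U hU hcover => ?_
  obtain ⟨s, hs⟩ := hK.elim_finite_subcover U hU (subset_union_left.trans hcover)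
  obtain ⟨y, hy, hyU⟩ := (hasBasis_nhdsOuter.tendsto_left_iff).1 hlim _
    ((isOpen_biUnion fun i _ => hU i).mem_nhdsSet.2 hs)
  have hsub : {w : ℂ | ‖w‖ ∈ Icc y x} ⊆ {w | ‖w‖ ∈ Ioc 1 x} := fun w hw => ⟨hy.trans_le hw.1, hw.2⟩
  have hcompact : IsCompact {w : ℂ | ‖w‖ ∈ Icc y x} := by
    refine (isCompact_closedBall (0 : ℂ) x).of_isClosed_subset
      (isClosed_Icc.preimage continuous_norm) fun w hw => mem_closedBall_zero_iff.2 hw.2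
  obtain ⟨t, ht⟩ := (hcompact.image_of_continuousOn (hκ.mono hsub)).elim_finite_subcover U hU
    ((image_mono hsub).trans (subset_union_right.trans hcover))
  classical
  refine ⟨s ∪ t, ?_⟩
  rw [Finset.set_biUnion_union]
  rintro _ (hz | ⟨w, hw, rfl⟩)
  · exact Or.inl (hs hz)
  · by_cases hwy : ‖w‖ < y
    · exact Or.inl (hyU ⟨hw.1, hwy⟩)
    · exact Or.inr (ht ⟨w, ⟨not_lt.1 hwy, hw.2⟩, rfl⟩)

namespace IsCollar

variable {K : Set ℂ} {R R' : ℝ} {κ J Φ : ℂ → ℂ} {w₀ p : ℂ} {ε : ℤ}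

theorem mono (h : IsCollar K R κ) (hR : R' ≤ R) : IsCollar K R' κ where
  continuousOn := h.continuousOn.mono (annulus_subset_annulus le_rfl hR)
  injOn := h.injOn.mono (annulus_subset_annulus le_rfl hR)
  notMem w hw := h.notMem w (annulus_subset_annulus le_rfl hR hw)
  tendsto := h.tendsto
  isOpen_union x hx := h.isOpen_union x ⟨hx.1, hx.2.trans_le hR⟩

theorem isCompact_union (h : IsCollar K R κ) (hK : IsCompact K) {x : ℝ} (hx : x < R) :
    IsCompact (K ∪ κ '' {w | ‖w‖ ∈ Ioc 1 x}) :=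
  isCompact_union_image hK (h.continuousOn.mono fun _ hw => ⟨hw.1, hw.2.trans_lt hx⟩) h.tendsto

theorem union_image_mem_nhdsSet (h : IsCollar K R κ) {x : ℝ} (hx : x ∈ Ioo 1 R) :
    K ∪ κ '' annulus 1 x ∈ 𝓝ˢ K :=
  (h.isOpen_union x hx).mem_nhdsSet.2 subset_union_left

theorem eventually_notMem (h : IsCollar K R κ) (hR : 1 < R) : ∀ᶠ w in nhdsOuter, κ w ∉ K :=
  (eventually_mem_annulus hR).mono fun w hw => h.notMem w hw

theorem mem_nhdsSet_iff (h : IsCollar K R κ) (hR : 1 < R) {S : Set ℂ} (hS : K ⊆ S) :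
    S ∈ 𝓝ˢ K ↔ ∀ᶠ w in nhdsOuter, κ w ∈ S := by
  refine ⟨fun hS => h.tendsto hS, fun hev => ?_⟩
  obtain ⟨y, hy, hyS⟩ := hasBasis_nhdsOuter.eventually_iff.1 hev
  obtain ⟨x, hx, hxR⟩ := exists_between (lt_min hy hR)
  rw [lt_min_iff] at hxR
  refine mem_of_superset (h.union_image_mem_nhdsSet ⟨hx, hxR.2⟩) (union_subset hS ?_)
  exact image_subset_iff.2 fun w hw => hyS (annulus_subset_annulus le_rfl hxR.1.le hw)

theorem map (h : IsCollar K R κ) (e : OpenPartialHomeomorph ℂ ℂ) (hK : K ⊆ e.source)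
    (hκ : MapsTo κ (annulus 1 R) e.source) : IsCollar (e '' K) R (e ∘ κ) where
  continuousOn := e.continuousOn.comp h.continuousOn hκ
  injOn := e.injOn.comp h.injOn hκ
  notMem := by
    rintro w hw ⟨z, hz, hzw⟩
    exact h.notMem w hw (e.injOn (hK hz) (hκ hw) hzw ▸ hz)
  tendsto := by
    refine Tendsto.comp (fun U hU => ?_) h.tendsto
    rw [mem_map, mem_nhdsSet_iff_forall]
    exact fun z hz => (e.continuousAt (hK hz)) (mem_nhdsSet_iff_forall.1 hU _ ⟨z, hz, rfl⟩)
  isOpen_union x hx := by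
    rw [image_comp, ← image_union]
    exact e.isOpen_image_of_subset_source (h.isOpen_union x hx) <| union_subset hK <|
      image_subset_iff.2 fun w hw => hκ (annulus_subset_annulus le_rfl hx.2.le hw)

/-- A connected piece `κ '' annulus 1 s` of the first collar close to `K` avoids the image of a
circle under `J`, so it lies entirely inside or entirely outside the image of the annulus bounded
by that circle. -/
theorem of_isOpen_image (h : IsCollar K R κ) (hK : IsCompact K) (hR : 1 < R)
    (hJ : ContinuousOn J (annulus 1 R')) (hinj : InjOn J (annulus 1 R'))
    (hJK : ∀ w ∈ annulus 1 R', J w ∉ K) (hlim : Tendsto J nhdsOuter (𝓝ˢ K))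
    (hopen : ∀ x ∈ Ioo 1 R', IsOpen (J '' annulus 1 x)) : IsCollar K R' J := by
  refine ⟨hJ, hinj, hJK, hlim, fun x hx => ?_⟩
  have hsphere : Metric.sphere 0 x ⊆ annulus 1 R' := sphere_subset_annulus hx.1 hx.2
  have hcircle : IsClosed (J '' Metric.sphere 0 x) :=
    ((isCompact_sphere 0 x).image_of_continuousOn (hJ.mono hsphere)).isClosed
  have hcompact : IsCompact (K ∪ J '' {w | ‖w‖ ∈ Ioc 1 x}) :=
    isCompact_union_image hK (hJ.mono fun w hw => ⟨hw.1, hw.2.trans_lt hx.2⟩) hlim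
  have hKcircle : K ⊆ (J '' Metric.sphere 0 x)ᶜ := by
    rintro z hz ⟨w, hw, rfl⟩
    exact hJK w (hsphere hw) hz
  obtain ⟨r, hr, hrcircle⟩ := hasBasis_nhdsOuter.eventually_iff.1
    (h.tendsto (hcircle.isOpen_compl.mem_nhdsSet.2 hKcircle))
  obtain ⟨s, hs, hsr⟩ := exists_between (lt_min hr hR)
  rw [lt_min_iff] at hsr
  suffices hsub : κ '' annulus 1 s ⊆ J '' annulus 1 x by
    rw [show K ∪ J '' annulus 1 x = (K ∪ κ '' annulus 1 s) ∪ J '' annulus 1 x by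
      rw [union_assoc, union_eq_self_of_subset_left hsub]]
    exact (h.isOpen_union s ⟨hs, hsr.2⟩).union (hopen x hx)
  refine ((isPreconnected_annulus zero_le_one s).image κ (h.continuousOn.mono
    (annulus_subset_annulus le_rfl hsr.2.le))).subset_left_of_subset_union (hopen x hx)
    hcompact.isClosed.isOpen_compl ?_ ?_ ?_
  · exact disjoint_compl_right_iff_subset.2 <| subset_union_of_subset_right
      (image_mono fun w (hw : w ∈ annulus 1 x) => show ‖w‖ ∈ Ioc 1 x from ⟨hw.1, hw.2.le⟩) K
  · rintro _ ⟨w, hw, rfl⟩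
    refine or_iff_not_imp_left.2 fun hout => ?_
    rintro (hwK | ⟨v, hv, hvw⟩)
    · exact h.notMem w (annulus_subset_annulus le_rfl hsr.2.le hw) hwK
    · rcases hv.2.lt_or_eq with hlt | heq
      · exact hout ⟨v, ⟨hv.1, hlt⟩, hvw⟩
      · exact hrcircle (annulus_subset_annulus le_rfl hsr.1.le hw)
          ⟨v, mem_sphere_zero_iff_norm.2 heq, hvw⟩
  · obtain ⟨w, hwx, hws⟩ := ((eventually_mem_annulus hx.1).and
      (hlim (h.union_image_mem_nhdsSet ⟨hs, hsr.2⟩))).exists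
    have hwK : J w ∉ K := hJK w (annulus_subset_annulus le_rfl hx.2.le hwx)
    exact ⟨J w, hws.resolve_left hwK, mem_image_of_mem J hwx⟩

theorem isPreconnected_union (h : IsCollar K R κ) (hK : IsPreconnected K) {x : ℝ} (hx : 1 < x)
    (hxR : x ≤ R) : IsPreconnected (K ∪ κ '' annulus 1 x) := by
  have himage := (isPreconnected_annulus zero_le_one x).image κ
    (h.continuousOn.mono (annulus_subset_annulus le_rfl hxR))
  have hsub : ∀ u v : Set ℂ, IsOpen u → IsOpen v → K ∪ κ '' annulus 1 x ⊆ u ∪ v →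
      (K ∪ κ '' annulus 1 x) ∩ (u ∩ v) = ∅ → K ⊆ u → K ∪ κ '' annulus 1 x ⊆ u := by
    intro u v hu hv hcover hdisj hKu
    obtain ⟨w, hwx, hwu⟩ :=
      ((eventually_mem_annulus hx).and (h.tendsto (hu.mem_nhdsSet.2 hKu))).exists
    refine union_subset hKu ?_
    refine (isPreconnected_iff_subset_of_disjoint.1 himage u v hu hv
      (subset_union_right.trans hcover) (subset_empty_iff.1 (hdisj ▸
        inter_subset_inter_left _ subset_union_right))).resolve_right fun hv' => ?_
    exact notMem_empty (κ w) (hdisj ▸ ⟨Or.inr ⟨w, hwx, rfl⟩, hwu, hv' ⟨w, hwx, rfl⟩⟩)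
  refine isPreconnected_iff_subset_of_disjoint.2 fun u v hu hv hcover hdisj => ?_
  refine (isPreconnected_iff_subset_of_disjoint.1 hK u v hu hv (subset_union_left.trans hcover)
    (subset_empty_iff.1 (hdisj ▸ inter_subset_inter_left _ subset_union_left))).imp
    (hsub u v hu hv hcover hdisj) ?_
  exact hsub v u hv hu (union_comm u v ▸ hcover) (inter_comm u v ▸ hdisj)

theorem hasDegree_sub_zero (h : IsCollar K R κ) (hK : IsCompact K) {x : ℝ} (hx : 1 < x)
    (hxw : x < ‖w₀‖) (hwR : ‖w₀‖ < R) :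
    HasDegree (Metric.sphere 0 x) (fun w => κ w - κ w₀) 0 := by
  have hx0 : 0 < x := one_pos.trans hx
  have hsphere : Metric.sphere 0 x ⊆ annulus 1 R := sphere_subset_annulus hx (hxw.trans hwR)
  have hκ := h.continuousOn.mono hsphere
  have hdisj : Disjoint (κ '' Metric.sphere 0 x) (κ '' annulus x R) := by
    rw [disjoint_left]
    rintro _ ⟨v, hv, rfl⟩ ⟨w, hw, hwv⟩
    have heq := h.injOn (annulus_subset_annulus hx.le le_rfl hw) (hsphere hv) hwv
    exact hw.1.ne' (heq ▸ mem_sphere_zero_iff_norm.1 hv)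
  have houter := (isPreconnected_annulus hx0.le R).image κ
    (h.continuousOn.mono (annulus_subset_annulus hx.le le_rfl))
  have hκw₀ : κ w₀ ∈ κ '' annulus x R := mem_image_of_mem κ ⟨hxw, hwR⟩
  obtain ⟨n, hn⟩ := exists_hasDegree_sphere (F := fun w => κ w - κ w₀) hx0
    (hκ.sub continuousOn_const) fun w hw hw0 => disjoint_left.1 hdisj
      (mem_image_of_mem κ hw) (sub_eq_zero.1 hw0 ▸ hκw₀)
  suffices n = 0 by rwa [this] at hn
  refine eq_zero_of_forall_mem_diff_hasDegree hx0 hκ (h.isCompact_union hK (hxw.trans hwR)) ?_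
    (h.isOpen_union _ ⟨hx.trans hxw, hwR⟩) ?_ ?_
  · exact subset_union_of_subset_right (image_mono fun w hw => by
      rw [mem_sphere_zero_iff_norm] at hw
      exact show ‖w‖ ∈ Ioc 1 x from ⟨hw ▸ hx, hw.le⟩) K
  · exact union_subset_union_right K (image_mono fun w hw => ⟨hw.1, hw.2.trans_lt hxw⟩)
  · rintro _ ⟨hqK | ⟨w, hw, rfl⟩, hq⟩
    · exact absurd (Or.inl hqK) hq
    · refine hn.of_isPreconnected hx0 hκ houter hdisj hκw₀ (mem_image_of_mem κ ⟨?_, hw.2.trans hwR⟩)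
      exact not_le.1 fun hwx => hq (Or.inr ⟨w, ⟨hw.1, hwx⟩, rfl⟩)

theorem hasDegree_sub_of_mem (h : IsCollar K R κ) (hK : IsCompact K) (hKc : IsPreconnected K)
    (hp : p ∈ K) (hw₀ : w₀ ∈ annulus 1 R) (hε : HasLocalDegree κ w₀ ε) :
    HasDegree (annulus 1 R) (fun w => κ w - p) ε := by
  obtain ⟨k, hk⟩ := exists_hasDegree_annulus zero_le_one (h.continuousOn.sub continuousOn_const)
    fun w hw hw0 => h.notMem w hw (sub_eq_zero.1 hw0 ▸ hp)
  suffices k = ε by rwa [this] at hk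
  obtain ⟨x, hx, hxw⟩ := exists_between hw₀.1
  obtain ⟨y, hwy, hyR⟩ := exists_between hw₀.2
  have hy : 1 < y := hw₀.1.trans hwy
  have hsphere := sphere_subset_annulus hy hyR
  have hdisj : Disjoint (κ '' Metric.sphere 0 y) (K ∪ κ '' annulus 1 y) := by
    rw [disjoint_left]
    rintro _ ⟨v, hv, rfl⟩ (hvK | ⟨w, hw, hwv⟩)
    · exact h.notMem v (hsphere hv) hvK
    · have heq := h.injOn (annulus_subset_annulus le_rfl hyR.le hw) (hsphere hv) hwv
      exact hw.2.ne (heq ▸ mem_sphere_zero_iff_norm.1 hv)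
  have houter : HasDegree (Metric.sphere 0 y) (fun w => κ w - κ w₀) k :=
    (hk.mono hsphere).of_isPreconnected (one_pos.trans hy) (h.continuousOn.mono hsphere)
      (h.isPreconnected_union hKc hy hyR.le) hdisj (Or.inl hp)
      (Or.inr (mem_image_of_mem κ ⟨hw₀.1, hwy⟩))
  have hlocal : HasLocalDegree (fun w => κ w - κ w₀) w₀ ε :=
    let ⟨r, hr, hdeg⟩ := hε
    ⟨r, hr, hdeg.congr fun δ _ => by rw [sub_sub_sub_cancel_right]⟩
  have hsum := HasDegree.eq_add_of_hasLocalDegree zero_le_one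
    (h.continuousOn.sub continuousOn_const) hw₀
    (fun w hw => sub_eq_zero.trans (h.injOn.eq_iff hw hw₀)) hlocal hx hxw hwy hyR
    (h.hasDegree_sub_zero hK hx hxw hw₀.2) houter
  rwa [zero_add] at hsum

theorem hasDegree_one_of_comp_eq (hκ : IsCollar K R κ) (hJ : IsCollar K R' J) (hK : IsCompact K)
    (hKc : IsConnected K) (hR' : R' ≤ R) (hw₀ : w₀ ∈ annulus 1 R') (hκε : HasLocalDegree κ w₀ ε)
    (hJε : HasLocalDegree J w₀ ε) (hε : ε ≠ 0) (hΦ : ContinuousOn Φ (annulus 1 R'))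
    (hmaps : MapsTo Φ (annulus 1 R') (annulus 1 R)) (hcomp : EqOn (κ ∘ Φ) J (annulus 1 R')) :
    HasDegree (annulus 1 R') Φ 1 := by
  obtain ⟨p, hp⟩ := hKc.nonempty
  have h0 : (0 : ℂ) ∉ annulus 1 R' := zero_notMem_annulus zero_le_one
  obtain ⟨m, hm⟩ := exists_hasDegree_annulus zero_le_one hΦ fun w hw hw0 =>
    zero_notMem_annulus zero_le_one (hw0 ▸ hmaps hw)
  have hκp := hκ.hasDegree_sub_of_mem hK hKc.isPreconnected hp
    (annulus_subset_annulus le_rfl hR' hw₀) hκε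
  have hJp := hJ.hasDegree_sub_of_mem hK hKc.isPreconnected hp hw₀ hJε
  have hJp' : HasDegree (annulus 1 R') (fun w => J w - p) (m * ε) :=
    (hκp.comp hm h0 hmaps).congr fun w hw => congrArg (· - p) (hcomp hw).symm
  have hmε : m * ε = ε := (hJp'.mono (sphere_subset_annulus hw₀.1 hw₀.2)).unique
    (hJp.mono (sphere_subset_annulus hw₀.1 hw₀.2)) (one_pos.trans hw₀.1)
  rwa [(mul_eq_right₀ hε).1 hmε] at hm

end IsCollar

section Estimate

variable {h : ℂ → ℂ} {c z : ℂ} {R : ℝ}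

theorem exists_differentiableOn_exp_eq (hR : 0 < R)
    (hd : DifferentiableOn ℂ h (Metric.ball c R)) (h0 : ∀ z ∈ Metric.ball c R, h z ≠ 0) :
    ∃ g : ℂ → ℂ, DifferentiableOn ℂ g (Metric.ball c R) ∧
      EqOn h (fun z => Complex.exp (g z)) (Metric.ball c R) := by
  have hc : c ∈ Metric.ball c R := Metric.mem_ball_self hR
  obtain ⟨g, hgc, hg⟩ :=
    ((hd.deriv Metric.isOpen_ball).div hd h0).isExactOn_ball.with_val_at c (Complex.log (h c))
  refine ⟨g, fun w hw => (hg w hw).differentiableAt.differentiableWithinAt, fun w hw => ?_⟩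
  have hderiv : ∀ v ∈ Metric.ball c R, HasDerivAt (fun v => h v * Complex.exp (-g v)) 0 v := by
    intro v hv
    refine (((hd.differentiableAt (Metric.isOpen_ball.mem_nhds hv)).hasDerivAt).mul
      (hg v hv).neg.cexp).congr_deriv ?_
    have hcancel : h v * (deriv h v / h v) = deriv h v := mul_div_cancel₀ _ (h0 v hv)
    rw [Pi.div_apply]
    linear_combination (-Complex.exp (-g v)) * hcancel
  have hconst : h w * Complex.exp (-g w) = h c * Complex.exp (-g c) :=
    Metric.isOpen_ball.is_const_of_deriv_eq_zero (convex_ball c R).isPreconnected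
      (fun v hv => (hderiv v hv).differentiableAt.differentiableWithinAt)
      (fun v hv => (hderiv v hv).deriv) hw hc
  rw [hgc, Complex.exp_neg (Complex.log _), Complex.exp_log (h0 c hc), mul_inv_cancel₀ (h0 c hc),
    Complex.exp_neg, ← div_eq_mul_inv, div_eq_one_iff_eq (Complex.exp_ne_zero _)] at hconst
  exact hconst

/-- Harnack's inequality for the nonnegative harmonic function `-log ‖h‖`. -/
theorem norm_sq_le_norm_center (hR : 0 < R) (hd : DifferentiableOn ℂ h (Metric.ball c R))
    (h0 : ∀ z ∈ Metric.ball c R, h z ≠ 0) (h1 : ∀ z ∈ Metric.ball c R, ‖h z‖ ≤ 1)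
    (hz : dist z c ≤ R / 5) : ‖h z‖ ^ 2 ≤ ‖h c‖ := by
  have hcm : c ∈ Metric.ball c R := Metric.mem_ball_self hR
  have hzm : z ∈ Metric.ball c R := Metric.mem_ball.2 (by linarith)
  rcases (h1 c hcm).eq_or_lt with hone | hlt
  · exact hone ▸ pow_le_one₀ (norm_nonneg _) (h1 z hzm)
  obtain ⟨g, hg, hexp⟩ := exists_differentiableOn_exp_eq hR hd h0
  have hnorm : ∀ w ∈ Metric.ball c R, ‖h w‖ = Real.exp (g w).re := fun w hw => by
    rw [hexp hw, Complex.norm_exp]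
  have hshift : MapsTo (· + c) (Metric.ball 0 R) (Metric.ball c R) := fun w hw => by
    rwa [mem_ball_iff_norm, add_sub_cancel_right, ← mem_ball_zero_iff]
  have hgc : 0 < -(g c).re := by
    rwa [neg_pos, ← Real.exp_lt_one_iff, ← hnorm c hcm]
  have hre : MapsTo (fun w => g (w + c) - g c) (Metric.ball 0 R) {w | w.re ≤ -(g c).re} := by
    intro w hw
    have hw1 := h1 _ (hshift hw)
    rw [hnorm _ (hshift hw), Real.exp_le_one_iff] at hw1
    rw [mem_ofPred_eq, Complex.sub_re]
    linarith
  have hbound := Complex.borelCaratheodory_zero hgc ((hg.comp (by fun_prop) hshift).sub_const _)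
    hre hR (z := z - c) (by rw [mem_ball_zero_iff, ← dist_eq_norm]; linarith) (by simp)
  rw [Function.comp_apply, sub_add_cancel, ← dist_eq_norm z c] at hbound
  have hhalf : 2 * -(g c).re * dist z c / (R - dist z c) ≤ -(g c).re / 2 := by
    rw [div_le_iff₀ (by linarith)]
    nlinarith
  have hdiff : (g z).re - (g c).re ≤ -(g c).re / 2 := by
    rw [← Complex.sub_re]
    exact (Complex.re_le_norm _).trans (hbound.trans hhalf)
  rw [hnorm z hzm, hnorm c hcm, ← Real.exp_nat_mul, Real.exp_le_exp]
  push_cast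
  linarith

theorem norm_pow_two_pow_le_of_segment {S : Set ℂ} {a b : ℂ} {N : ℕ} (hR : 0 < R)
    (hd : DifferentiableOn ℂ h S) (h0 : ∀ z ∈ S, h z ≠ 0) (h1 : ∀ z ∈ S, ‖h z‖ ≤ 1)
    (hS : ∀ z ∈ segment ℝ a b, Metric.ball z R ⊆ S) (hN : dist a b ≤ N * (R / 5)) :
    ‖h b‖ ^ 2 ^ N ≤ ‖h a‖ := by
  rcases N.eq_zero_or_pos with rfl | hNpos
  · rw [Nat.cast_zero, zero_mul, dist_le_zero] at hN
    rw [hN, pow_zero, pow_one]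
  have hN0 : (0 : ℝ) < N := Nat.cast_pos.2 hNpos
  let p : ℕ → ℂ := fun i => AffineMap.lineMap a b (i / N : ℝ)
  have hstep : ∀ i, dist (p (i + 1)) (p i) ≤ R / 5 := fun i => by
    rw [dist_lineMap_lineMap, Real.dist_eq, Nat.cast_add_one, add_div, add_sub_cancel_left,
      abs_of_pos (one_div_pos.2 hN0), one_div_mul_eq_div, div_le_iff₀' hN0]
    exact hN
  have hp : ∀ i ≤ N, p i ∈ segment ℝ a b := fun i hi => by
    rw [segment_eq_image_lineMap]
    exact mem_image_of_mem _ ⟨by positivity, (div_le_one hN0).2 (Nat.cast_le.2 hi)⟩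
  have hchain : ∀ i ≤ N, ‖h (p i)‖ ^ 2 ^ i ≤ ‖h a‖ := by
    intro i
    induction i with
    | zero => simp [p]
    | succ i ih =>
      intro hi
      have hball := hS _ (hp i (Nat.le_of_succ_le hi))
      have hsq := norm_sq_le_norm_center hR (hd.mono hball) (fun z hz => h0 z (hball hz))
        (fun z hz => h1 z (hball hz)) (hstep i)
      calc ‖h (p (i + 1))‖ ^ 2 ^ (i + 1) = (‖h (p (i + 1))‖ ^ 2) ^ 2 ^ i := by
            rw [pow_succ', pow_mul]
        _ ≤ ‖h (p i)‖ ^ 2 ^ i := by gcongr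
        _ ≤ ‖h a‖ := ih (Nat.le_of_succ_le hi)
  have hlast := hchain N le_rfl
  simpa only [p, div_self hN0.ne', AffineMap.lineMap_apply_one] using hlast

theorem norm_pow_two_pow_le_of_strip {a b : ℂ} {y C m : ℝ} {N : ℕ}
    (hd : DifferentiableOn ℂ h (Complex.re ⁻¹' Ioo 0 y)) (h0 : ∀ z, z.re ∈ Ioo 0 y → h z ≠ 0)
    (h1 : ∀ z, z.re ∈ Ioo 0 y → ‖h z‖ ≤ 1) (ha : 0 < a.re) (hy : (2 + C) * a.re ≤ y)
    (hm : 0 < m) (hm1 : m ≤ 1) (hab : ‖b - a‖ ≤ C * a.re) (hb : m * a.re ≤ b.re)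
    (hN : 5 * C ≤ m * N) : ‖h b‖ ^ 2 ^ N ≤ ‖h a‖ := by
  have hma : m * a.re ≤ a.re := mul_le_of_le_one_left ha.le hm1
  refine norm_pow_two_pow_le_of_segment (mul_pos hm ha) hd h0 h1 (fun q hq z hz => ?_) ?_
  · have hqre : q.re ∈ Icc (m * a.re) ((1 + C) * a.re) := by
      refine ((convex_Icc _ _).linear_preimage Complex.reLm).segment_subset ⟨hma, ?_⟩ ⟨hb, ?_⟩ hq
      · rw [Complex.reLm_coe]
        linarith [(norm_nonneg _).trans hab]
      · have hba := (Complex.re_le_norm (b - a)).trans hab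
        rw [Complex.sub_re] at hba
        rw [Complex.reLm_coe]
        linarith
    have hzq := (Complex.abs_re_le_norm (z - q)).trans_lt (mem_ball_iff_norm.1 hz)
    rw [Complex.sub_re, abs_lt] at hzq
    constructor <;> linarith [hqre.1, hqre.2]
  · rw [dist_comm, dist_eq_norm]
    nlinarith

end Estimate

theorem mapsTo_exp_annulus {x : ℝ} (hx : 0 < x) :
    MapsTo Complex.exp (Complex.re ⁻¹' Ioo 0 (Real.log x)) (annulus 1 x) := fun s hs => by
  rw [annulus, mem_ofPred_eq, Complex.norm_exp]
  exact ⟨Real.one_lt_exp_iff.2 hs.1, (Real.lt_log_iff_exp_lt hx).1 hs.2⟩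

theorem tendsto_log_norm_nhdsOuter : Tendsto (fun w : ℂ => Real.log ‖w‖) nhdsOuter (𝓝 0) := by
  rw [← Real.log_one]
  exact ((Real.continuousAt_log one_ne_zero).tendsto.mono_left nhdsWithin_le_nhds).comp
    tendsto_comap

namespace IsCollar

variable {K : Set ℂ} {R C m : ℝ} {κ D : ℂ → ℂ}

theorem exists_forall_dist_div_pow_le (h : IsCollar K R κ) (hK : IsCompact K) (hR : 1 < R)
    (hd : DifferentiableOn ℂ κ (annulus 1 R)) (hm : 0 < m)
    (hD : ∀ᶠ w in nhdsOuter,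
      ‖D w‖ ≤ C * Real.log ‖w‖ ∧ m * Real.log ‖w‖ ≤ Real.log ‖w‖ + (D w).re) :
    ∃ (M : ℝ) (n : ℕ), 0 < M ∧ ∀ᶠ w in nhdsOuter, ∀ p ∈ K,
      (dist (κ (w * Complex.exp (D w))) p / M) ^ n ≤ dist (κ w) p / M := by
  obtain ⟨x, hx, hxR⟩ := exists_between hR
  have hmaps := mapsTo_exp_annulus (one_pos.trans hx)
  have hbdd := (h.isCompact_union hK hxR).isBounded
  set M := Metric.diam (K ∪ κ '' {w | ‖w‖ ∈ Ioc 1 x}) + 1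
  have hM : 0 < M := add_pos_of_nonneg_of_pos Metric.diam_nonneg one_pos
  obtain ⟨N, hN⟩ := exists_nat_ge (5 * C / min m 1)
  rw [div_le_iff₀' (lt_min hm one_pos)] at hN
  have hlog : ∀ᶠ w : ℂ in nhdsOuter, (2 + C) * Real.log ‖w‖ < Real.log x := by
    refine Tendsto.eventually_lt_const (Real.log_pos hx) ?_
    simpa only [mul_zero] using tendsto_log_norm_nhdsOuter.const_mul (2 + C)
  refine ⟨M, 2 ^ N, hM, ?_⟩
  filter_upwards [hD, hlog, eventually_mem_annulus hx] with w ⟨hwC, hwm⟩ hwx hw p hp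
  have hexp : Complex.exp (Complex.log w) = w :=
    Complex.exp_log (norm_pos_iff.1 (one_pos.trans hw.1))
  have hlogw : 0 < Real.log ‖w‖ := Real.log_pos hw.1
  have hnorm : ∀ s, ‖(κ (Complex.exp s) - p) / M‖ = dist (κ (Complex.exp s)) p / M := fun s => by
    rw [norm_div, Complex.norm_real, Real.norm_of_nonneg hM.le, dist_eq_norm]
  have hbound := norm_pow_two_pow_le_of_strip (h := fun s => (κ (Complex.exp s) - p) / M)
    (a := Complex.log w) (b := Complex.log w + D w) (m := min m 1)
    (((hd.comp Complex.differentiable_exp.differentiableOn fun s hs =>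
      annulus_subset_annulus le_rfl hxR.le (hmaps hs)).sub_const p).div_const _)
    (fun s hs h0 => ?_) (fun s hs => ?_) ?_ ?_ (lt_min hm one_pos) (min_le_right _ _) ?_ ?_ hN
  · rwa [hnorm, hnorm, Complex.exp_add, hexp] at hbound
  · rw [div_eq_zero_iff, sub_eq_zero, or_iff_left (Complex.ofReal_ne_zero.2 hM.ne')] at h0
    exact h.notMem _ (annulus_subset_annulus le_rfl hxR.le (hmaps hs)) (h0 ▸ hp)
  · rw [hnorm, div_le_one hM]
    exact (Metric.dist_le_diam_of_mem hbdd
      (Or.inr (mem_image_of_mem κ ⟨(hmaps hs).1, (hmaps hs).2.le⟩)) (Or.inl hp)).trans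
        (le_add_of_nonneg_right zero_le_one)
  · rwa [Complex.log_re]
  · rw [Complex.log_re]
    exact hwx.le
  · rwa [Complex.log_re, add_sub_cancel_left]
  · rw [Complex.log_re, Complex.add_re, Complex.log_re]
    exact (mul_le_mul_of_nonneg_right (min_le_left _ _) hlogw.le).trans hwm

theorem tendsto_dist_mul_exp (h : IsCollar K R κ) (hK : IsCompact K) (hR : 1 < R)
    (hd : DifferentiableOn ℂ κ (annulus 1 R)) (hm : 0 < m)
    (hD : ∀ᶠ w in nhdsOuter,
      ‖D w‖ ≤ C * Real.log ‖w‖ ∧ m * Real.log ‖w‖ ≤ Real.log ‖w‖ + (D w).re) :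
    Tendsto (fun w => dist (κ (w * Complex.exp (D w))) (κ w)) nhdsOuter (𝓝 0) := by
  obtain ⟨M, n, hM, hle⟩ := h.exists_forall_dist_div_pow_le hK hR hd hm hD
  refine Metric.tendsto_nhds.2 fun ε hε => ?_
  set δ := min (ε / 2) (M * (ε / (2 * M)) ^ n) with hδ
  have hδ0 : 0 < δ := by positivity
  filter_upwards [hle, h.tendsto (Metric.thickening_mem_nhdsSet K hδ0)] with w hw hwK
  obtain ⟨p, hp, hwp⟩ := Metric.mem_thickening_iff.1 hwK
  rw [hδ, lt_min_iff, mul_comm M, ← div_lt_iff₀ hM] at hwp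
  have hnear : dist (κ (w * Complex.exp (D w))) p < ε / 2 := by
    have hpow := lt_of_pow_lt_pow_left₀ n (by positivity) ((hw p hp).trans_lt hwp.2)
    rw [div_lt_iff₀ hM] at hpow
    refine hpow.trans_eq ?_
    field_simp
  rw [dist_zero_right, Real.norm_of_nonneg dist_nonneg]
  linarith [dist_triangle_right (κ (w * Complex.exp (D w))) (κ w) p]

end IsCollar

section PowInvariance

variable {d : ℕ} {R r : ℝ}

/-- A compact annulus which meets every orbit of `w ↦ w ^ d` starting in `annulus 1 r`. -/
def fundamentalAnnulus (d : ℕ) (r : ℝ) : Set ℂ := {w | r ≤ ‖w‖ ^ d ∧ ‖w‖ ≤ r}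

theorem isCompact_fundamentalAnnulus (d : ℕ) (r : ℝ) :
    IsCompact (fundamentalAnnulus d r) :=
  (isCompact_closedBall (0 : ℂ) r).of_isClosed_subset
    ((isClosed_le continuous_const (continuous_norm.pow d)).inter
      (isClosed_le continuous_norm continuous_const)) fun _ hw => mem_closedBall_zero_iff.2 hw.2

theorem fundamentalAnnulus_subset_annulus (hd : d ≠ 0) (hr : 1 < r) (hrR : r < R) :
    fundamentalAnnulus d r ⊆ annulus 1 R := fun w hw =>
  ⟨(one_lt_pow_iff_of_nonneg (norm_nonneg w) hd).1 (hr.trans_le hw.1), hw.2.trans_lt hrR⟩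

theorem image_annulus_subset_of_pow_invariant {α : Type*} {Q : ℂ → α} (hd : 1 < d) (hrR : r < R)
    (hQ : ∀ w ∈ annulus 1 R, w ^ d ∈ annulus 1 R → Q (w ^ d) = Q w) :
    Q '' annulus 1 r ⊆ Q '' fundamentalAnnulus d r := by
  rintro _ ⟨w, hw, rfl⟩
  have hex : ∃ n : ℕ, r ≤ (‖w‖ ^ d ^ n) ^ d := by
    have hlim := (tendsto_pow_atTop_atTop_of_one_lt hw.1).comp
      ((tendsto_pow_atTop_atTop_of_one_lt hd).comp (tendsto_add_atTop_nat 1))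
    obtain ⟨n, hn⟩ := (hlim.eventually_ge_atTop r).exists
    exact ⟨n, by simpa only [Function.comp_apply, pow_succ, pow_mul] using hn⟩
  have hlt : ∀ n ≤ Nat.find hex, ‖w ^ d ^ n‖ < r := by
    rintro (_ | n) hn
    · simpa using hw.2
    · simpa only [norm_pow, pow_succ, pow_mul, not_le] using Nat.find_min hex hn
  have hmem : ∀ n ≤ Nat.find hex, w ^ d ^ n ∈ annulus 1 R := fun n hn =>
    ⟨by simpa only [norm_pow] using one_lt_pow₀ hw.1 (pow_ne_zero n (by omega)),
      (hlt n hn).trans hrR⟩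
  have hinv : ∀ n ≤ Nat.find hex, Q (w ^ d ^ n) = Q w := by
    intro n
    induction n with
    | zero => simp
    | succ n ih =>
      intro hn
      have hsucc := hmem (n + 1) hn
      rw [pow_succ, pow_mul] at hsucc ⊢
      rw [hQ _ (hmem n (Nat.le_of_succ_le hn)) hsucc, ih (Nat.le_of_succ_le hn)]
  refine ⟨w ^ d ^ Nat.find hex, ⟨?_, (hlt _ le_rfl).le⟩, hinv _ le_rfl⟩
  simpa only [norm_pow] using Nat.find_spec hex

theorem exists_bounds_of_homogeneous {D : ℂ → ℂ} (hd : 1 < d) (hR : 1 < R)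
    (hD : ContinuousOn D (annulus 1 R))
    (hpow : ∀ w ∈ annulus 1 R, w ^ d ∈ annulus 1 R → D (w ^ d) = d * D w)
    (hpos : ∀ w ∈ annulus 1 R, 0 < Real.log ‖w‖ + (D w).re) :
    ∃ C m : ℝ, 0 < m ∧ ∀ᶠ w in nhdsOuter,
      ‖D w‖ ≤ C * Real.log ‖w‖ ∧ m * Real.log ‖w‖ ≤ Real.log ‖w‖ + (D w).re := by
  obtain ⟨r, hr, hrR⟩ := exists_between hR
  have hlog : ∀ w ∈ annulus 1 R, 0 < Real.log ‖w‖ := fun w hw => Real.log_pos hw.1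
  have hlogc : ContinuousOn (fun w : ℂ => Real.log ‖w‖) (annulus 1 R) :=
    continuous_norm.continuousOn.log fun w hw => (one_pos.trans hw.1).ne'
  let Q : ℂ → ℂ := fun w => D w / Real.log ‖w‖
  have hQ : ContinuousOn Q (annulus 1 R) := hD.div
    (Complex.continuous_ofReal.comp_continuousOn hlogc)
    fun w hw => Complex.ofReal_ne_zero.2 (hlog w hw).ne'
  have hsub := fundamentalAnnulus_subset_annulus (d := d) (by omega) hr hrR
  have hcompact := (isCompact_fundamentalAnnulus d r).image_of_continuousOn (hQ.mono hsub)
  have hQsub : Q '' annulus 1 r ⊆ Q '' fundamentalAnnulus d r :=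
    image_annulus_subset_of_pow_invariant hd hrR fun w hw hwd => by
      simp only [Q, hpow w hw hwd, norm_pow, Real.log_pow, Complex.ofReal_mul,
        Complex.ofReal_natCast]
      exact mul_div_mul_left _ _ (Nat.cast_ne_zero.2 (by omega))
  have hre : ∀ w ∈ annulus 1 R, 1 + (Q w).re = (Real.log ‖w‖ + (D w).re) / Real.log ‖w‖ :=
    fun w hw => by rw [Complex.div_ofReal_re, add_div, div_self (hlog w hw).ne']
  obtain ⟨C, hC⟩ := hcompact.isBounded.exists_norm_le
  obtain ⟨m, hm, hmQ⟩ := hcompact.exists_forall_le' (f := fun q => 1 + q.re) (a := 0) (by fun_prop)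
    (by
      rintro _ ⟨w, hw, rfl⟩
      rw [hre w (hsub hw)]
      exact div_pos (hpos w (hsub hw)) (hlog w (hsub hw)))
  refine ⟨C, m, hm, (eventually_mem_annulus hr).mono fun w hw => ?_⟩
  have hwR := annulus_subset_annulus le_rfl hrR.le hw
  have hCw := hC _ (hQsub (mem_image_of_mem Q hw))
  have hmw := hmQ _ (hQsub (mem_image_of_mem Q hw))
  rw [hre w hwR, le_div_iff₀ (hlog w hwR)] at hmw
  rw [norm_div, Complex.norm_real, Real.norm_of_nonneg (hlog w hwR).le,
    div_le_iff₀ (hlog w hwR)] at hCw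
  exact ⟨hCw, hmw⟩

end PowInvariance

section HolomorphicInverse

variable {e : OpenPartialHomeomorph ℂ ℂ}

theorem eventually_deriv_ne_zero {z : ℂ} (he : DifferentiableOn ℂ e e.source) (hz : z ∈ e.source) :
    ∀ᶠ v in 𝓝[≠] z, deriv e v ≠ 0 := by
  have hsource := e.open_source.mem_nhds hz
  refine (he.analyticAt hsource).deriv.eventually_eq_zero_or_eventually_ne_zero.resolve_left
    fun hzero => ?_
  obtain ⟨r, hr, hball⟩ := Metric.mem_nhds_iff.1 (hzero.and hsource)
  obtain ⟨v, hvr, hvz⟩ : (Metric.ball z r ∩ {z}ᶜ).Nonempty :=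
    (𝓝[≠] z).nonempty_of_mem <| inter_mem (nhdsWithin_le_nhds (Metric.ball_mem_nhds z hr))
      self_mem_nhdsWithin
  exact hvz <| e.injOn (hball hvr).2 hz <| Metric.isOpen_ball.is_const_of_deriv_eq_zero
    (convex_ball z r).isPreconnected (he.mono fun v hv => (hball hv).2) (fun v hv => (hball hv).1)
    hvr (Metric.mem_ball_self hr)

theorem differentiableOn_symm (he : DifferentiableOn ℂ e e.source) :
    DifferentiableOn ℂ e.symm e.target := by
  intro w hw
  have hcont : ContinuousAt e.symm w := e.symm.continuousAt hw
  have htarget : ∀ᶠ v in 𝓝[≠] w, v ∈ e.target := nhdsWithin_le_nhds (e.open_target.mem_nhds hw)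
  have hlim : Tendsto e.symm (𝓝[≠] w) (𝓝[≠] (e.symm w)) := by
    refine tendsto_nhdsWithin_iff.2 ⟨hcont.tendsto.mono_left nhdsWithin_le_nhds, ?_⟩
    filter_upwards [htarget, self_mem_nhdsWithin] with v hv hvw heq
    exact hvw (e.symm.injOn hv hw heq)
  refine (Complex.analyticAt_of_differentiable_on_punctured_nhds_of_continuousAt ?_
    hcont).differentiableAt.differentiableWithinAt
  filter_upwards [hlim.eventually (eventually_deriv_ne_zero he (e.map_target hw)), htarget]
    with v hv hvt
  exact (e.hasDerivAt_symm hvt hv (he.differentiableAt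
    (e.open_source.mem_nhds (e.map_target hvt))).hasDerivAt).differentiableAt

end HolomorphicInverse

theorem isPreconnected_setOf_lt_norm {M : ℝ} (hM : 0 ≤ M) : IsPreconnected {w : ℂ | M < ‖w‖} :=
  isPreconnected_of_forall_pair fun v hv w hw =>
    ⟨annulus M (max ‖v‖ ‖w‖ + 1), fun _ hu => hu.1,
      ⟨hv, (le_max_left _ _).trans_lt (lt_add_one _)⟩,
      ⟨hw, (le_max_right _ _).trans_lt (lt_add_one _)⟩, isPreconnected_annulus hM _⟩

namespace IsBottcher

variable {P : Polynomial ℂ} {B : OpenPartialHomeomorph ℂ ℂ} {w z : ℂ} {x R : ℝ}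

theorem mem_source_iff (hB : IsBottcher P B) : z ∈ B.source ↔ z ∉ polyFilledJulia P := by
  rw [hB.source_eq, mem_compl_iff]

theorem mem_target_iff (hB : IsBottcher P B) : w ∈ B.target ↔ 1 < ‖w‖ := by
  rw [hB.target_eq, mem_ofPred_eq]

theorem one_lt_norm (hB : IsBottcher P B) (hz : z ∈ B.source) : 1 < ‖B z‖ :=
  hB.mem_target_iff.1 (B.map_source hz)

theorem mem_image_symm (hB : IsBottcher P B) (hz : z ∈ B.source) (hzx : ‖B z‖ < x) :
    z ∈ B.symm '' annulus 1 x :=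
  ⟨B z, ⟨hB.one_lt_norm hz, hzx⟩, B.left_inv hz⟩

theorem tendsto_norm_atTop (hB : IsBottcher P B) :
    Tendsto (fun z => ‖B z‖) (cocompact ℂ) atTop := by
  refine (hB.tangent.norm.pos_mul_atTop (by rw [norm_one]; exact one_pos)
    (tendsto_norm_cocompact_atTop (E := ℂ))).congr' ?_
  filter_upwards [(finite_singleton (0 : ℂ)).isCompact.compl_mem_cocompact] with z hz
  rw [← norm_mul, div_mul_cancel₀ _ hz]

/-- If `m` bounds `B` on the circle `‖z‖ = R`, then `B.symm` maps the connected set `m < ‖w‖` to one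
side of that circle, necessarily the outer one since `B` has a pole at infinity. -/
theorem exists_norm_le_of_norm_lt (hB : IsBottcher P B) (hK : polyFilledJulia P ⊆ Metric.ball 0 R) :
    ∃ M, ∀ z ∈ B.source, ‖z‖ < R → ‖B z‖ ≤ M := by
  have hsphere : Metric.sphere 0 R ⊆ B.source := fun z hz => hB.mem_source_iff.2 fun hzK =>
    (mem_ball_zero_iff.1 (hK hzK)).ne (mem_sphere_zero_iff_norm.1 hz)
  obtain ⟨M, hM⟩ := (isCompact_sphere (0 : ℂ) R).exists_bound_of_continuousOn
    (B.continuousOn.mono hsphere)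
  set m := max 1 M
  have hnear : IsOpen (B '' (B.source ∩ {z | ‖z‖ < R})) := B.isOpen_image_of_subset_source
    (B.open_source.inter (isOpen_lt continuous_norm continuous_const)) inter_subset_left
  have hfar : IsOpen (B '' (B.source ∩ {z | R < ‖z‖})) := B.isOpen_image_of_subset_source
    (B.open_source.inter (isOpen_lt continuous_const continuous_norm)) inter_subset_left
  have hdisj : Disjoint (B '' (B.source ∩ {z | R < ‖z‖})) (B '' (B.source ∩ {z | ‖z‖ < R})) := by
    rw [disjoint_left]
    rintro _ ⟨z, hz, rfl⟩ ⟨v, hv, hvz⟩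
    rw [B.injOn hv.1 hz.1 hvz] at hv
    exact lt_asymm (show R < ‖z‖ from hz.2) (show ‖z‖ < R from hv.2)
  have hcover : {w : ℂ | m < ‖w‖} ⊆
      B '' (B.source ∩ {z | R < ‖z‖}) ∪ B '' (B.source ∩ {z | ‖z‖ < R}) := by
    intro w hw
    have hwt : w ∈ B.target := hB.mem_target_iff.2 ((le_max_left _ _).trans_lt hw)
    have hws := B.map_target hwt
    rcases lt_trichotomy ‖B.symm w‖ R with hlt | heq | hgt
    · exact Or.inr ⟨B.symm w, ⟨hws, hlt⟩, B.right_inv hwt⟩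
    · have hwM := hM _ (mem_sphere_zero_iff_norm.2 heq)
      rw [B.right_inv hwt] at hwM
      exact absurd ((le_max_right _ _).trans_lt hw) hwM.not_gt
    · exact Or.inl ⟨B.symm w, ⟨hws, hgt⟩, B.right_inv hwt⟩
  obtain ⟨u, hum, huR⟩ := ((hB.tendsto_norm_atTop.eventually_gt_atTop m).and
    ((tendsto_norm_cocompact_atTop (E := ℂ)).eventually_gt_atTop R)).exists
  have hus : u ∈ B.source := hB.mem_source_iff.2 fun huK =>
    lt_asymm huR (mem_ball_zero_iff.1 (hK huK))
  have hsub := (isPreconnected_setOf_lt_norm (zero_le_one.trans (le_max_left 1 M))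
    ).subset_left_of_subset_union hfar hnear hdisj hcover
      ⟨B u, hum, mem_image_of_mem B ⟨hus, huR⟩⟩
  exact ⟨m, fun z hz hzR => not_lt.1 fun hzm =>
    disjoint_left.1 hdisj (hsub hzm) (mem_image_of_mem B ⟨hz, hzR⟩)⟩

theorem tendsto_symm (hB : IsBottcher P B) :
    Tendsto B.symm nhdsOuter (𝓝ˢ (polyFilledJulia P)) := by
  refine (hasBasis_nhdsSet _).tendsto_right_iff.2 fun U ⟨hU, hKU⟩ => ?_
  have hsource : Uᶜ ⊆ B.source := fun z hz => hB.mem_source_iff.2 fun hzK => hz (hKU hzK)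
  obtain ⟨m, hm, hUm⟩ : ∃ m > 1, ∀ z ∈ Uᶜ, m ≤ ‖B z‖ := by
    rcases Uᶜ.eq_empty_or_nonempty with hempty | ⟨z₀, hz₀⟩
    · exact ⟨2, one_lt_two, fun z hz => absurd hz (hempty ▸ notMem_empty z)⟩
    · obtain ⟨z, hz, hmin⟩ := (B.continuousOn.mono hsource).norm.exists_isMinOn' hU.isClosed_compl
        hz₀ (hB.tendsto_norm_atTop.eventually_ge_atTop _ |>.filter_mono inf_le_left)
      exact ⟨‖B z‖, hB.one_lt_norm (hsource hz), fun v hv => hmin hv⟩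
  filter_upwards [eventually_mem_annulus hm] with w hw
  by_contra hwU
  have hle := hUm _ hwU
  rw [B.right_inv (hB.mem_target_iff.2 hw.1)] at hle
  exact hw.2.not_ge hle

theorem isOpen_union_image_symm (hB : IsBottcher P B) (hK : IsCompact (polyFilledJulia P))
    (hx : 1 < x) : IsOpen (polyFilledJulia P ∪ B.symm '' annulus 1 x) := by
  obtain ⟨R, hKR⟩ := hK.isBounded.subset_ball 0
  obtain ⟨M, hM⟩ := hB.exists_norm_le_of_norm_lt hKR
  have htarget : {w : ℂ | ‖w‖ ∈ Icc x M} ⊆ B.target := fun w hw =>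
    hB.mem_target_iff.2 (hx.trans_le hw.1)
  have hA : IsCompact (B.symm '' {w | ‖w‖ ∈ Icc x M}) :=
    ((isCompact_closedBall (0 : ℂ) M).of_isClosed_subset (isClosed_Icc.preimage continuous_norm)
      fun w hw => mem_closedBall_zero_iff.2 hw.2).image_of_continuousOn
        (B.continuousOn_symm.mono htarget)
  refine isOpen_iff_mem_nhds.2 ?_
  rintro z (hz | ⟨w, hw, rfl⟩)
  · have hzA : z ∉ B.symm '' {w | ‖w‖ ∈ Icc x M} := by
      rintro ⟨w, hw, rfl⟩
      exact hB.mem_source_iff.1 (B.map_target (htarget hw)) hz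
    filter_upwards [Metric.isOpen_ball.mem_nhds (hKR hz), hA.isClosed.isOpen_compl.mem_nhds hzA]
      with v hvR hvA
    refine or_iff_not_imp_left.2 fun hvK => ?_
    have hvs := hB.mem_source_iff.2 hvK
    exact hB.mem_image_symm hvs <| not_le.1 fun hxv =>
      hvA ⟨B v, ⟨hxv, hM v hvs (mem_ball_zero_iff.1 hvR)⟩, B.left_inv hvs⟩
  · refine mem_of_superset ((B.symm.isOpen_image_of_subset_source (isOpen_annulus 1 x) fun v hv =>
      hB.mem_target_iff.2 hv.1).mem_nhds (mem_image_of_mem _ hw)) subset_union_right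

theorem isCollar_symm (hB : IsBottcher P B) (hK : IsCompact (polyFilledJulia P)) (R : ℝ) :
    IsCollar (polyFilledJulia P) R B.symm where
  continuousOn := B.continuousOn_symm.mono fun _ hw => hB.mem_target_iff.2 hw.1
  injOn := B.symm.injOn.mono fun _ hw => hB.mem_target_iff.2 hw.1
  notMem _ hw := hB.mem_source_iff.1 (B.map_target (hB.mem_target_iff.2 hw.1))
  tendsto := hB.tendsto_symm
  isOpen_union _ hx := hB.isOpen_union_image_symm hK hx.1

end IsBottcher

/-- `f : V₂ → V₁` is a continuous proper map, with `V₂` open and compactly contained in `V₁`: the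
topological part of the definition of a polynomial-like map. The values of `f` outside `V₂` play
no role. -/
structure IsTopologicalPolynomialLike (V₂ V₁ : Set ℂ) (f : ℂ → ℂ) : Prop where
  isOpen_dom : IsOpen V₂
  isCompact_closure : IsCompact (closure V₂)
  closure_subset : closure V₂ ⊆ V₁
  continuousOn : ContinuousOn f V₂
  proper : ∀ C ⊆ V₁, IsCompact C → IsCompact (V₂ ∩ f ⁻¹' C)

theorem IsPolynomialLike.isTopologicalPolynomialLike {d : ℕ} {V₂ V₁ : Set ℂ} {f : ℂ → ℂ}
    (hf : IsPolynomialLike d V₂ V₁ f) : IsTopologicalPolynomialLike V₂ V₁ f :=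
  ⟨hf.isOpen_dom, hf.isCompact_closure, hf.closure_subset, hf.holomorphic.continuousOn, hf.proper⟩

/-- The points whose first `n` iterates (the point itself included) lie in `V` and whose `n`-th
image lies in `S`. With `S = closure V` this is a decreasing sequence of compact sets, with `S = V`
one of open sets, and both shrink to the filled Julia set. -/
def iterPreimage (V : Set ℂ) (f : ℂ → ℂ) (S : Set ℂ) : ℕ → Set ℂ
  | 0 => S
  | n + 1 => V ∩ f ⁻¹' iterPreimage V f S n

section Dynamics

variable {V₂ V₁ S T U : Set ℂ} {f : ℂ → ℂ} {z : ℂ}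

theorem mem_filledJulia_iff : z ∈ filledJulia V₂ f ↔ z ∈ V₂ ∧ f z ∈ filledJulia V₂ f := by
  refine ⟨fun h => ⟨h 0, fun n => h (n + 1)⟩, fun ⟨h0, h⟩ n => ?_⟩
  cases n with
  | zero => exact h0
  | succ n => exact h n

theorem iterPreimage_mono (h : S ⊆ T) (n : ℕ) : iterPreimage V₂ f S n ⊆ iterPreimage V₂ f T n := by
  induction n with
  | zero => exact h
  | succ n ih => exact inter_subset_inter_right _ (preimage_mono ih)

theorem filledJulia_subset_iterPreimage (n : ℕ) : filledJulia V₂ f ⊆ iterPreimage V₂ f V₂ n := by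
  induction n with
  | zero => exact fun z hz => hz 0
  | succ n ih => exact fun z hz => ⟨hz 0, ih (mem_filledJulia_iff.1 hz).2⟩

theorem antitone_iterPreimage_closure : Antitone (iterPreimage V₂ f (closure V₂)) := by
  refine antitone_nat_of_succ_le fun n => ?_
  induction n with
  | zero => exact inter_subset_left.trans subset_closure
  | succ n ih => exact inter_subset_inter_right _ (preimage_mono ih)

theorem iInter_iterPreimage_closure :
    ⋂ n, iterPreimage V₂ f (closure V₂) n = filledJulia V₂ f := by
  refine Subset.antisymm (fun z hz n => ?_) <| subset_iInter fun n =>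
    (filledJulia_subset_iterPreimage n).trans (iterPreimage_mono subset_closure n)
  rw [mem_iInter] at hz
  induction n generalizing z with
  | zero => exact (hz 1).1
  | succ _ ih => exact ih (f z) fun m => (hz (m + 1)).2

namespace IsTopologicalPolynomialLike

theorem isCompact_iterPreimage_closure (hf : IsTopologicalPolynomialLike V₂ V₁ f) (n : ℕ) :
    IsCompact (iterPreimage V₂ f (closure V₂) n) := by
  induction n with
  | zero => exact hf.isCompact_closure
  | succ n ih =>
    exact hf.proper _ ((antitone_iterPreimage_closure (Nat.zero_le n)).trans hf.closure_subset) ih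

theorem isCompact_filledJulia (hf : IsTopologicalPolynomialLike V₂ V₁ f) :
    IsCompact (filledJulia V₂ f) := by
  rw [← iInter_iterPreimage_closure]
  exact (hf.isCompact_iterPreimage_closure 0).of_isClosed_subset
    (isClosed_iInter fun n => (hf.isCompact_iterPreimage_closure n).isClosed) (iInter_subset _ 0)

theorem exists_iterPreimage_closure_subset (hf : IsTopologicalPolynomialLike V₂ V₁ f)
    (hU : IsOpen U) (hKU : filledJulia V₂ f ⊆ U) : ∃ n, iterPreimage V₂ f (closure V₂) n ⊆ U := by
  rw [← iInter_iterPreimage_closure] at hKU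
  exact exists_subset_nhds_of_isCompact antitone_iterPreimage_closure.directed_ge
    hf.isCompact_iterPreimage_closure fun z hz => hU.mem_nhds (hKU hz)

theorem iterPreimage_mem_nhdsSet (hf : IsTopologicalPolynomialLike V₂ V₁ f) (n : ℕ) :
    iterPreimage V₂ f V₂ n ∈ 𝓝ˢ (filledJulia V₂ f) := by
  refine IsOpen.mem_nhdsSet ?_ |>.2 (filledJulia_subset_iterPreimage n)
  induction n with
  | zero => exact hf.isOpen_dom
  | succ n ih => exact hf.continuousOn.isOpen_inter_preimage hf.isOpen_dom ih

end IsTopologicalPolynomialLike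

variable {φ : ℂ → ℂ}

theorem mapsTo_iterPreimage_closure
    (hφ : ∀ z ∈ V₂ \ filledJulia V₂ f, φ z ∈ V₂ ∧ φ (f z) = f (φ z)) (n : ℕ) :
    MapsTo φ (iterPreimage V₂ f V₂ n \ filledJulia V₂ f) (iterPreimage V₂ f (closure V₂) n) := by
  induction n with
  | zero => exact fun z hz => subset_closure (hφ z hz).1
  | succ n ih =>
    rintro z ⟨⟨hzV, hfz⟩, hzK⟩
    obtain ⟨hφz, hcomm⟩ := hφ z ⟨hzV, hzK⟩
    refine ⟨hφz, ?_⟩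
    rw [mem_preimage, ← hcomm]
    exact ih ⟨hfz, fun h => hzK (mem_filledJulia_iff.2 ⟨hzV, h⟩)⟩

theorem IsTopologicalPolynomialLike.tendsto_of_commute (hf : IsTopologicalPolynomialLike V₂ V₁ f)
    (hφ : ∀ z ∈ V₂ \ filledJulia V₂ f, φ z ∈ V₂ ∧ φ (f z) = f (φ z)) :
    Tendsto φ (𝓝ˢ (filledJulia V₂ f) ⊓ 𝓟 (filledJulia V₂ f)ᶜ) (𝓝ˢ (filledJulia V₂ f)) := by
  refine (hasBasis_nhdsSet _).tendsto_right_iff.2 fun U ⟨hU, hKU⟩ => ?_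
  obtain ⟨n, hn⟩ := hf.exists_iterPreimage_closure_subset hU hKU
  refine eventually_inf_principal.2 ?_
  filter_upwards [hf.iterPreimage_mem_nhdsSet n] with z hz hzK
  exact hn (mapsTo_iterPreimage_closure hφ n ⟨hz, hzK⟩)

end Dynamics

namespace IsStraightening

variable {d : ℕ} {V₂ V₁ : Set ℂ} {f : ℂ → ℂ} {P : Polynomial ℂ} {χ : OpenPartialHomeomorph ℂ ℂ}

theorem map_mem_iff (hχ : IsStraightening d V₂ f P χ) {z : ℂ} (hz : z ∈ χ.source) :
    χ z ∈ polyFilledJulia P ↔ z ∈ filledJulia V₂ f := by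
  rw [← hχ.image_eq]
  exact χ.injOn.mem_image_iff hχ.subset_source hz

theorem isCompact_polyFilledJulia (hχ : IsStraightening d V₂ f P χ)
    (hf : IsTopologicalPolynomialLike V₂ V₁ f) : IsCompact (polyFilledJulia P) :=
  hχ.image_eq ▸
    hf.isCompact_filledJulia.image_of_continuousOn (χ.continuousOn.mono hχ.subset_source)

theorem polyFilledJulia_subset_target (hχ : IsStraightening d V₂ f P χ) :
    polyFilledJulia P ⊆ χ.target :=
  hχ.image_eq ▸ (χ.mapsTo.mono_left hχ.subset_source).image_subset

theorem symm_image_polyFilledJulia (hχ : IsStraightening d V₂ f P χ) :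
    χ.symm '' polyFilledJulia P = filledJulia V₂ f := by
  rw [← hχ.image_eq]
  exact χ.symm_image_image_of_subset_source hχ.subset_source

end IsStraightening

/-- `Ψ` is an external chart of `f`: a homeomorphism from a subset of the complement of the filled
Julia set that contains all points close to it, whose inverse is a collar of the filled Julia set on
the annulus `1 < ‖w‖ < R` and which conjugates `f` to `w ↦ w ^ d`. -/
structure IsExternalChart (d : ℕ) (V₂ : Set ℂ) (f : ℂ → ℂ) (R : ℝ)
    (Ψ : OpenPartialHomeomorph ℂ ℂ) : Prop where
  one_lt : 1 < R
  annulus_subset : annulus 1 R ⊆ Ψ.target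
  isCollar : IsCollar (filledJulia V₂ f) R Ψ.symm
  mapsTo : MapsTo Ψ.symm (annulus 1 R) V₂
  map_mem_source : ∀ w ∈ annulus 1 R, f (Ψ.symm w) ∈ Ψ.source
  semiconj : ∀ w ∈ annulus 1 R, Ψ (f (Ψ.symm w)) = w ^ d

section Existence

variable {d : ℕ} {V₂ V₁ : Set ℂ} {f : ℂ → ℂ} {P : Polynomial ℂ} {χ B : OpenPartialHomeomorph ℂ ℂ}

theorem exists_isExternalChart (hf : IsTopologicalPolynomialLike V₂ V₁ f)
    (hχ : IsStraightening d V₂ f P χ) (hB : IsBottcher P B) :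
    ∃ R, IsExternalChart d V₂ f R (χ.trans B) := by
  set W := χ.source ∩ (V₂ ∩ f ⁻¹' χ.source)
  have hW : IsOpen W := χ.open_source.inter
    (hf.continuousOn.isOpen_inter_preimage hf.isOpen_dom χ.open_source)
  have hKW : filledJulia V₂ f ⊆ W := fun z hz =>
    ⟨hχ.subset_source hz, hz 0, hχ.subset_source (mem_filledJulia_iff.1 hz).2⟩
  obtain ⟨R, hR, hRW⟩ := hasBasis_nhdsOuter.eventually_iff.1 <| hB.tendsto_symm <|
    (χ.isOpen_inter_preimage_symm hW).mem_nhdsSet.2 fun z hz =>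
      ⟨hχ.polyFilledJulia_subset_target hz,
        hKW (hχ.symm_image_polyFilledJulia ▸ mem_image_of_mem _ hz)⟩
  have hcollar := (hB.isCollar_symm (hχ.isCompact_polyFilledJulia hf) R).map χ.symm
    hχ.polyFilledJulia_subset_target fun w hw => (hRW hw).1
  rw [hχ.symm_image_polyFilledJulia] at hcollar
  have hmem : ∀ w ∈ annulus 1 R, f (χ.symm (B.symm w)) ∈ (χ.trans B).source := fun w hw => by
    refine ⟨(hRW hw).2.2.2, hB.mem_source_iff.2 fun hK => hcollar.notMem w hw ?_⟩
    exact mem_filledJulia_iff.2 ⟨(hRW hw).2.2.1, (hχ.map_mem_iff (hRW hw).2.2.2).1 hK⟩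
  refine ⟨R, hR, fun w hw => ⟨hB.mem_target_iff.2 hw.1, (hRW hw).1⟩, hcollar,
    fun w hw => (hRW hw).2.2.1, hmem, fun w hw => ?_⟩
  have hw1 := hB.mem_target_iff.2 hw.1
  obtain ⟨ht, hs, hV, hfs⟩ := hRW hw
  calc B (χ (f (χ.symm (B.symm w)))) = B (P.eval (B.symm w)) := by
        rw [hχ.conj _ hs hV hfs, χ.right_inv ht]
    _ = w ^ d := by rw [hB.semiconj _ (B.map_target hw1), B.right_inv hw1, hχ.natDegree_eq]

end Existence

namespace IsExternalChart

variable {d : ℕ} {V₂ V₁ : Set ℂ} {f : ℂ → ℂ} {R r : ℝ} {φ Ψ : OpenPartialHomeomorph ℂ ℂ} {w : ℂ}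

theorem symm_pow (hΨ : IsExternalChart d V₂ f R Ψ) (hw : w ∈ annulus 1 R) :
    Ψ.symm (w ^ d) = f (Ψ.symm w) := by
  rw [← hΨ.semiconj w hw, Ψ.left_inv (hΨ.map_mem_source w hw)]

theorem symm_mem_diff (hΨ : IsExternalChart d V₂ f R Ψ) (hw : w ∈ annulus 1 R) :
    Ψ.symm w ∈ V₂ \ filledJulia V₂ f :=
  ⟨hΨ.mapsTo hw, hΨ.isCollar.notMem w hw⟩

theorem isCollar_comp (hΨ : IsExternalChart d V₂ f R Ψ)
    (hf : IsTopologicalPolynomialLike V₂ V₁ f) (hφs : V₂ \ filledJulia V₂ f ⊆ φ.source)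
    (hφt : Disjoint φ.target (filledJulia V₂ f))
    (hφ : ∀ z ∈ V₂ \ filledJulia V₂ f, φ z ∈ V₂ ∧ φ (f z) = f (φ z)) :
    IsCollar (filledJulia V₂ f) R (φ ∘ Ψ.symm) := by
  have hmaps : MapsTo Ψ.symm (annulus 1 R) φ.source := fun w hw => hφs (hΨ.symm_mem_diff hw)
  refine hΨ.isCollar.of_isOpen_image hf.isCompact_filledJulia hΨ.one_lt
    (φ.continuousOn.comp hΨ.isCollar.continuousOn hmaps) (φ.injOn.comp hΨ.isCollar.injOn hmaps)
    (fun w hw => disjoint_left.1 hφt (φ.map_source (hmaps hw))) ?_ fun x hx => ?_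
  · exact (hf.tendsto_of_commute hφ).comp <| tendsto_inf.2 ⟨hΨ.isCollar.tendsto,
      tendsto_principal.2 (hΨ.isCollar.eventually_notMem hΨ.one_lt)⟩
  · have hsub : annulus 1 x ⊆ annulus 1 R := annulus_subset_annulus le_rfl hx.2.le
    rw [image_comp]
    exact φ.isOpen_image_of_subset_source (Ψ.symm.isOpen_image_of_subset_source (isOpen_annulus 1 x)
      (hsub.trans hΨ.annulus_subset)) (image_subset_iff.2 (hmaps.mono_left hsub))

theorem exists_mapsTo_image (hΨ : IsExternalChart d V₂ f R Ψ)
    (hJ : IsCollar (filledJulia V₂ f) R (φ ∘ Ψ.symm)) :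
    ∃ r ∈ Ioc 1 R, MapsTo (φ ∘ Ψ.symm) (annulus 1 r) (Ψ.symm '' annulus 1 R) := by
  obtain ⟨x, hx, hxR⟩ := exists_between hΨ.one_lt
  obtain ⟨y, hy, hyx⟩ := hasBasis_nhdsOuter.eventually_iff.1
    (hJ.tendsto (hΨ.isCollar.union_image_mem_nhdsSet ⟨hx, hxR⟩))
  refine ⟨min y R, ⟨lt_min hy hΨ.one_lt, min_le_right y R⟩, fun w hw => ?_⟩
  exact image_mono (annulus_subset_annulus le_rfl hxR.le) <|
    (hyx (annulus_subset_annulus le_rfl (min_le_left y R) hw)).resolve_left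
      (hJ.notMem w (annulus_subset_annulus le_rfl (min_le_right y R) hw))

theorem transition_mem (hΨ : IsExternalChart d V₂ f R Ψ)
    (hw : φ (Ψ.symm w) ∈ Ψ.symm '' annulus 1 R) :
    φ (Ψ.symm w) ∈ Ψ.source ∧ Ψ (φ (Ψ.symm w)) ∈ annulus 1 R := by
  obtain ⟨v, hv, hvw⟩ := hw
  rw [← hvw, Ψ.right_inv (hΨ.annulus_subset hv)]
  exact ⟨Ψ.map_target (hΨ.annulus_subset hv), hv⟩

theorem exists_transition (hΨ : IsExternalChart d V₂ f R Ψ)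
    (hf : IsTopologicalPolynomialLike V₂ V₁ f) (hK : IsConnected (filledJulia V₂ f))
    (hφs : V₂ \ filledJulia V₂ f ⊆ φ.source) (hφt : Disjoint φ.target (filledJulia V₂ f))
    (hφo : OrientationPreserving φ)
    (hφ : ∀ z ∈ V₂ \ filledJulia V₂ f, φ z ∈ V₂ ∧ φ (f z) = f (φ z)) :
    ∃ r ∈ Ioc 1 R, (∀ w ∈ annulus 1 r, φ (Ψ.symm w) ∈ Ψ.source ∧
        Ψ (φ (Ψ.symm w)) ∈ annulus 1 R) ∧
      HasDegree (annulus 1 r) (fun w => Ψ (φ (Ψ.symm w))) 1 ∧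
      ∀ w ∈ annulus 1 r, Ψ (φ (Ψ.symm (w ^ d))) = Ψ (φ (Ψ.symm w)) ^ d := by
  have hJ := hΨ.isCollar_comp hf hφs hφt hφ
  obtain ⟨r, hr, hmaps⟩ := hΨ.exists_mapsTo_image hJ
  have hmem : ∀ w ∈ annulus 1 r, φ (Ψ.symm w) ∈ Ψ.source ∧ Ψ (φ (Ψ.symm w)) ∈ annulus 1 R :=
    fun w hw => hΨ.transition_mem (hmaps hw)
  have hsub : annulus 1 r ⊆ annulus 1 R := annulus_subset_annulus le_rfl hr.2
  refine ⟨r, hr, hmem, ?_, fun w hw => ?_⟩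
  · obtain ⟨t, ht⟩ := exists_between hr.1
    have hw₀ : (t : ℂ) ∈ annulus 1 r := ofReal_mem_annulus zero_le_one ht
    have hw₀t : (t : ℂ) ∈ Ψ.symm.source := hΨ.annulus_subset (hsub hw₀)
    obtain ⟨ε, hε⟩ := exists_hasLocalDegree Ψ.symm hw₀t
    have hJε : HasLocalDegree (φ ∘ Ψ.symm) t ε := mul_one ε ▸
      (hφo.hasLocalDegree (hφs (hΨ.symm_mem_diff (hsub hw₀)))).comp hε (Ψ.symm.continuousAt hw₀t)
    exact hΨ.isCollar.hasDegree_one_of_comp_eq (hJ.mono hr.2) hf.isCompact_filledJulia hK hr.2 hw₀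
      hε hJε (hε.ne_zero hw₀t)
      (Ψ.continuousOn.comp (hJ.continuousOn.mono hsub) fun w hw => (hmem w hw).1)
      (fun w hw => (hmem w hw).2) fun w hw => Ψ.left_inv (hmem w hw).1
  · rw [hΨ.symm_pow (hsub hw), (hφ _ (hΨ.symm_mem_diff (hsub hw))).2, ← Ψ.left_inv (hmem w hw).1,
      hΨ.semiconj _ (hmem w hw).2, Ψ.left_inv (hmem w hw).1]

end IsExternalChart

theorem exists_nat_lt_exp_eq {d : ℕ} (hd : 1 < d) (n : ℤ) : ∃ j < d - 1,
    Complex.exp ((2 * Real.pi * j / ((d : ℝ) - 1) : ℝ) * Complex.I) =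
      Complex.exp (n * (2 * Real.pi * Complex.I) / ((d : ℂ) - 1)) := by
  have hd0 : (0 : ℤ) < d - 1 := by omega
  have hdC : (d : ℂ) - 1 ≠ 0 := by exact_mod_cast hd0.ne'
  obtain ⟨j, hj⟩ := Int.eq_ofNat_of_zero_le (Int.emod_nonneg n hd0.ne')
  have hn : (j : ℂ) = n - (d - 1) * (n / (d - 1 : ℤ) : ℤ) := by
    rw [← Int.cast_natCast, ← hj, Int.emod_def]
    push_cast
    rfl
  refine ⟨j, by have := Int.emod_lt_of_pos n hd0; omega, ?_⟩
  refine Complex.exp_eq_exp_iff_exists_int.2 ⟨-(n / (d - 1 : ℤ)), ?_⟩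
  push_cast
  rw [hn]
  field_simp
  ring

theorem isPreconnected_setOf_pow_mem_annulus {d : ℕ} {r : ℝ} (hd : d ≠ 0) (hr : 0 ≤ r) :
    IsPreconnected {w : ℂ | w ∈ annulus 1 r ∧ w ^ d ∈ annulus 1 r} := by
  obtain ⟨s, hs, rfl⟩ : ∃ s : ℝ, 0 ≤ s ∧ s ^ d = r :=
    ⟨r ^ (d⁻¹ : ℝ), Real.rpow_nonneg hr _, Real.rpow_inv_natCast_pow hr hd⟩
  convert isPreconnected_annulus zero_le_one s using 1
  ext w
  have hlt : ‖w ^ d‖ < s ^ d ↔ ‖w‖ < s := by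
    rw [norm_pow, pow_lt_pow_iff_left₀ (norm_nonneg w) hs hd]
  refine ⟨fun h => ⟨h.1.1, hlt.1 h.2.2⟩, fun h => ?_⟩
  have hpow : 1 < ‖w ^ d‖ := norm_pow w d ▸ one_lt_pow₀ h.1 hd
  have hself : ‖w‖ ≤ ‖w ^ d‖ := norm_pow w d ▸ le_self_pow₀ h.1.le hd
  exact ⟨⟨h.1, hself.trans_lt (hlt.2 h.2)⟩, hpow, hlt.2 h.2⟩

theorem HasDegree.exists_homogeneous_log {d : ℕ} {r : ℝ} {Φ : ℂ → ℂ} (hd : 1 < d) (hr : 0 ≤ r)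
    (hΦ : HasDegree (annulus 1 r) Φ 1)
    (hpow : ∀ w ∈ annulus 1 r, w ^ d ∈ annulus 1 r → Φ (w ^ d) = Φ w ^ d) :
    ∃ j < d - 1, ∃ D : ℂ → ℂ, ContinuousOn D (annulus 1 r) ∧
      (∀ w ∈ annulus 1 r, Complex.exp ((2 * Real.pi * j / ((d : ℝ) - 1) : ℝ) * Complex.I) * Φ w =
        w * Complex.exp (D w)) ∧
      ∀ w ∈ annulus 1 r, w ^ d ∈ annulus 1 r → D (w ^ d) = d * D w := by
  obtain ⟨L, hL, hΦL⟩ := hΦ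
  simp only [zpow_one] at hΦL
  have hdC : (d : ℂ) - 1 ≠ 0 := sub_ne_zero.2 (by exact_mod_cast hd.ne')
  obtain ⟨n, hn⟩ : ∃ n : ℤ, ∀ w ∈ {w | w ∈ annulus 1 r ∧ w ^ d ∈ annulus 1 r},
      L (w ^ d) = d * L w + n * (2 * Real.pi * Complex.I) := by
    refine exists_int_of_exp_eq (isPreconnected_setOf_pow_mem_annulus (by omega) hr)
      (hL.comp (by fun_prop) fun w hw => hw.2) (continuousOn_const.mul (hL.mono fun w hw => hw.1))
      fun w ⟨hw, hwd⟩ => ?_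
    have hw0 : w ^ d ≠ 0 := fun h0 => zero_notMem_annulus zero_le_one (h0 ▸ hwd)
    refine mul_left_cancel₀ hw0 ?_
    rw [← hΦL _ hwd, hpow w hw hwd, hΦL w hw, mul_pow, Complex.exp_nat_mul]
  obtain ⟨j, hj, hexp⟩ := exists_nat_lt_exp_eq hd n
  refine ⟨j, hj, fun w => L w + n * (2 * Real.pi * Complex.I) / (d - 1),
    hL.add continuousOn_const, fun w hw => ?_, fun w hw hwd => ?_⟩
  · rw [hexp, hΦL w hw, Complex.exp_add]
    ring
  · simp only [hn w ⟨hw, hwd⟩]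
    field_simp
    ring

section Extension

variable {K D : Set ℂ} {R : ℝ} {κ ψ g : ℂ → ℂ}

theorem IsCollar.extendsAsIdentity (h : IsCollar K R κ) (hK : IsClosed K) (hR : 1 < R)
    (hψ : ContinuousOn ψ D) (hD : ∀ᶠ w in nhdsOuter, κ w ∈ D)
    (hdist : Tendsto (fun w => dist (ψ (κ w)) (κ w)) nhdsOuter (𝓝 0)) :
    ExtendsAsIdentity K D ψ := by
  refine ⟨(h.mem_nhdsSet_iff hR subset_union_right).2 (hD.mono fun w hw => Or.inl hw),
    fun z hz => ?_⟩
  by_cases hzK : z ∈ K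
  · refine ContinuousAt.continuousWithinAt (Metric.continuousAt_iff'.2 fun ε hε => ?_)
    have hclose : {v | v ∈ K ∨ dist (ψ v) v < ε / 2} ∈ 𝓝ˢ K :=
      (h.mem_nhdsSet_iff hR fun v hv => Or.inl hv).2 <|
        (hdist.eventually_lt_const (half_pos hε)).mono fun w hw => Or.inr hw
    filter_upwards [mem_nhdsSet_iff_forall.1 hclose z hzK, Metric.ball_mem_nhds z (half_pos hε)]
      with v hv hvz
    rw [if_pos hzK]
    have hvz' : dist v z < ε / 2 := hvz
    split_ifs with hvK
    · linarith
    · linarith [dist_triangle (ψ v) v z, hv.resolve_left hvK]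
  · have hKz : ∀ᶠ v in 𝓝 z, v ∉ K := hK.isOpen_compl.mem_nhds hzK
    refine ((hψ z (hz.resolve_right hzK)).congr_of_eventuallyEq ?_ (if_neg hzK)
      ).mono_of_mem_nhdsWithin ?_
    · exact (hKz.filter_mono inf_le_left).mono fun v hv => if_neg hv
    filter_upwards [self_mem_nhdsWithin, hKz.filter_mono inf_le_left] with v hv hvK
    exact hv.resolve_right hvK

theorem tendsto_dist_comp_of_isCompact {ι : Type*} {l : Filter ι} {u v : ι → ℂ}
    (hK : IsCompact K) (hg : ∀ z ∈ K, ContinuousAt g z) (hu : Tendsto u l (𝓝ˢ K))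
    (huv : Tendsto (fun i => dist (u i) (v i)) l (𝓝 0)) :
    Tendsto (fun i => dist (g (u i)) (g (v i))) l (𝓝 0) := by
  refine Metric.tendsto_nhds.2 fun ε hε => ?_
  obtain ⟨δ, hδ, hunif⟩ := Metric.mem_uniformity_dist.1 <|
    hK.uniformContinuousAt_of_continuousAt g hg (Metric.dist_mem_uniformity (half_pos hε))
  filter_upwards [hu (Metric.isOpen_thickening.mem_nhdsSet.2
      (Metric.self_subset_thickening (half_pos hδ) K)),
    huv.eventually_lt_const (half_pos hδ)] with i hi huvi
  obtain ⟨p, hpK, hpu⟩ := Metric.mem_thickening_iff.1 hi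
  rw [dist_comm] at hpu
  have hpgu := hunif (hpu.trans (half_lt_self hδ)) hpK
  have hpgv := hunif (show dist p (v i) < δ by linarith [dist_triangle p (u i) (v i)]) hpK
  rw [Real.dist_0_eq_abs, abs_of_nonneg dist_nonneg]
  simp only [mem_ofPred_eq] at hpgu hpgv
  linarith [dist_triangle_left (g (u i)) (g (v i)) (g p)]

end Extension

section Rotation

variable {d : ℕ} {V₂ V₁ : Set ℂ} {f : ℂ → ℂ} {P : Polynomial ℂ} {χ B : OpenPartialHomeomorph ℂ ℂ}
  {θ : ℝ} {z : ℂ}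

theorem mem_rotationDomain_iff (hχ : IsStraightening d V₂ f P χ) (hB : IsBottcher P B) :
    z ∈ rotationDomain (filledJulia V₂ f) χ B θ ↔ z ∈ (χ.trans B).source ∧
      Complex.exp (θ * Complex.I) * (χ.trans B) z ∈ (χ.trans B).target := by
  have hsource : z ∈ (χ.trans B).source ↔ z ∈ χ.source \ filledJulia V₂ f :=
    and_congr_right fun hz => hB.mem_source_iff.trans (not_congr (hχ.map_mem_iff hz))
  rw [hsource]
  refine and_congr_right fun hz => ⟨fun h => ⟨?_, h⟩, fun h => h.2⟩
  refine hB.mem_target_iff.2 ?_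
  rw [norm_mul, Complex.norm_exp_ofReal_mul_I, one_mul]
  exact hB.one_lt_norm (hsource.2 hz).2

theorem continuousOn_rotation (hχ : IsStraightening d V₂ f P χ) (hB : IsBottcher P B) :
    ContinuousOn (rotation χ B θ) (rotationDomain (filledJulia V₂ f) χ B θ) :=
  (χ.trans B).continuousOn_symm.comp (continuousOn_const.mul ((χ.trans B).continuousOn.mono
    fun _ hz => ((mem_rotationDomain_iff hχ hB).1 hz).1))
    fun _ hz => ((mem_rotationDomain_iff hχ hB).1 hz).2

theorem tendsto_dist_symm_mul_exp {D : ℂ → ℂ} {C m : ℝ}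
    (hf : IsTopologicalPolynomialLike V₂ V₁ f) (hχ : IsStraightening d V₂ f P χ)
    (hB : IsBottcher P B) (hm : 0 < m)
    (hD : ∀ᶠ w in nhdsOuter,
      ‖D w‖ ≤ C * Real.log ‖w‖ ∧ m * Real.log ‖w‖ ≤ Real.log ‖w‖ + (D w).re) :
    Tendsto (fun w => dist ((χ.trans B).symm (w * Complex.exp (D w))) ((χ.trans B).symm w))
      nhdsOuter (𝓝 0) := by
  have hK := hχ.isCompact_polyFilledJulia hf
  have hdist := (hB.isCollar_symm hK 2).tendsto_dist_mul_exp hK one_lt_two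
    ((differentiableOn_symm hB.holomorphic).mono fun w hw => hB.mem_target_iff.2 hw.1) hm hD
  simp only [dist_comm (B.symm (_ * _))] at hdist
  simp only [dist_comm ((χ.trans B).symm (_ * _))]
  exact tendsto_dist_comp_of_isCompact (g := χ.symm) hK
    (fun z hz => χ.symm.continuousAt (hχ.polyFilledJulia_subset_target hz)) hB.tendsto_symm hdist

end Rotation

theorem IsExternalChart.exists_rotation_comp_eq_mul_exp {d : ℕ} {V₂ V₁ : Set ℂ} {f : ℂ → ℂ} {R : ℝ}
    {φ Ψ : OpenPartialHomeomorph ℂ ℂ} (hd : 1 < d) (hΨ : IsExternalChart d V₂ f R Ψ)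
    (hf : IsTopologicalPolynomialLike V₂ V₁ f) (hK : IsConnected (filledJulia V₂ f))
    (hφs : V₂ \ filledJulia V₂ f ⊆ φ.source) (hφt : Disjoint φ.target (filledJulia V₂ f))
    (hφo : OrientationPreserving φ)
    (hφ : ∀ z ∈ V₂ \ filledJulia V₂ f, φ z ∈ V₂ ∧ φ (f z) = f (φ z)) :
    ∃ j < d - 1, ∃ (D : ℂ → ℂ) (C m : ℝ), 0 < m ∧
      (∀ᶠ w in nhdsOuter,
        ‖D w‖ ≤ C * Real.log ‖w‖ ∧ m * Real.log ‖w‖ ≤ Real.log ‖w‖ + (D w).re) ∧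
      ∀ᶠ w in nhdsOuter, φ (Ψ.symm w) ∈ Ψ.source ∧ w * Complex.exp (D w) ∈ Ψ.target ∧
        Complex.exp ((2 * Real.pi * j / ((d : ℝ) - 1) : ℝ) * Complex.I) * Ψ (φ (Ψ.symm w)) =
          w * Complex.exp (D w) := by
  obtain ⟨r, hr, hmem, hdeg, hpow⟩ := hΨ.exists_transition hf hK hφs hφt hφo hφ
  obtain ⟨j, hj, D, hD, hrot, hhom⟩ := hdeg.exists_homogeneous_log hd (zero_le_one.trans hr.1.le)
    fun w hw _ => hpow w hw
  have hannulus : ∀ w ∈ annulus 1 r, w * Complex.exp (D w) ∈ annulus 1 R := fun w hw => by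
    have hnorm : ‖w * Complex.exp (D w)‖ = ‖Ψ (φ (Ψ.symm w))‖ := by
      rw [← hrot w hw, norm_mul, Complex.norm_exp_ofReal_mul_I, one_mul]
    exact ⟨hnorm ▸ (hmem w hw).2.1, hnorm ▸ (hmem w hw).2.2⟩
  obtain ⟨C, m, hm, hbound⟩ := exists_bounds_of_homogeneous hd hr.1 hD hhom fun w hw => by
    have hlog := Real.log_pos (hannulus w hw).1
    rwa [norm_mul, Complex.norm_exp, Real.log_mul (one_pos.trans hw.1).ne' (Real.exp_ne_zero _),
      Real.log_exp] at hlog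
  refine ⟨j, hj, D, C, m, hm, hbound, (eventually_mem_annulus hr.1).mono fun w hw => ?_⟩
  exact ⟨(hmem w hw).1, hΨ.annulus_subset (hannulus w hw), hrot w hw⟩

end PolyLike

theorem mainTheorem6_general (d : ℕ) (hd : 2 ≤ d) (V₂ V₁ : Set ℂ) (f : ℂ → ℂ)
    (hf : PolyLike.IsTopologicalPolynomialLike V₂ V₁ f)
    (hK : IsConnected (PolyLike.filledJulia V₂ f))
    (φ : OpenPartialHomeomorph ℂ ℂ)
    (hφs : V₂ \ PolyLike.filledJulia V₂ f ⊆ φ.source)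
    (hφt : Disjoint φ.target (PolyLike.filledJulia V₂ f))
    (hφo : PolyLike.OrientationPreserving φ)
    (hφ : ∀ z ∈ V₂ \ PolyLike.filledJulia V₂ f, φ z ∈ V₂ ∧ φ (f z) = f (φ z))
    (P : Polynomial ℂ) (χ B : OpenPartialHomeomorph ℂ ℂ)
    (hχ : PolyLike.IsStraightening d V₂ f P χ)
    (hB : PolyLike.IsBottcher P B) :
    ∃ j : ℕ, j < d - 1 ∧
      PolyLike.ExtendsAsIdentity (PolyLike.filledJulia V₂ f)
        (φ.source ∩ φ ⁻¹' PolyLike.rotationDomain (PolyLike.filledJulia V₂ f) χ B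
          (2 * Real.pi * j / ((d : ℝ) - 1)))
        (PolyLike.rotation χ B (2 * Real.pi * j / ((d : ℝ) - 1)) ∘ φ) := by
  obtain ⟨R, hΨ⟩ := PolyLike.exists_isExternalChart hf hχ hB
  obtain ⟨j, hj, D, C, m, hm, hbound, hrot⟩ :=
    hΨ.exists_rotation_comp_eq_mul_exp hd hf hK hφs hφt hφo hφ
  refine ⟨j, hj, hΨ.isCollar.extendsAsIdentity hf.isCompact_filledJulia.isClosed hΨ.one_lt
    ((PolyLike.continuousOn_rotation hχ hB).comp (φ.continuousOn.mono inter_subset_left)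
      fun _ hz => hz.2) ?_ ?_⟩
  · filter_upwards [hrot, PolyLike.eventually_mem_annulus hΨ.one_lt] with w ⟨hs, ht, heq⟩ hw
    exact ⟨hφs (hΨ.symm_mem_diff hw), (PolyLike.mem_rotationDomain_iff hχ hB).2 ⟨hs, heq ▸ ht⟩⟩
  · refine (PolyLike.tendsto_dist_symm_mul_exp hf hχ hB hm hbound).congr' ?_
    filter_upwards [hrot] with w ⟨_, _, heq⟩
    rw [← heq]
    rfl

theorem mainTheorem6 (d : ℕ) (hd : 2 ≤ d) (V₂ V₁ : Set ℂ) (f : ℂ → ℂ)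
    (hf : PolyLike.IsPolynomialLike d V₂ V₁ f)
    (hK : IsConnected (PolyLike.filledJulia V₂ f))
    (φ : OpenPartialHomeomorph ℂ ℂ)
    (hφs : φ.source = V₁ \ PolyLike.filledJulia V₂ f)
    (hφt : φ.target = V₁ \ PolyLike.filledJulia V₂ f)
    (hφo : PolyLike.OrientationPreserving φ)
    (hφ : ∀ z ∈ V₂ \ PolyLike.filledJulia V₂ f, φ z ∈ V₂ ∧ φ (f z) = f (φ z))
    (P : Polynomial ℂ) (χ B : OpenPartialHomeomorph ℂ ℂ)
    (hχ : PolyLike.IsStraightening d V₂ f P χ)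
    (hB : PolyLike.IsBottcher P B) :
    ∃ j : ℕ, j < d - 1 ∧
      PolyLike.ExtendsAsIdentity (PolyLike.filledJulia V₂ f)
        (φ.source ∩ φ ⁻¹' PolyLike.rotationDomain (PolyLike.filledJulia V₂ f) χ B
          (2 * Real.pi * j / ((d : ℝ) - 1)))
        (PolyLike.rotation χ B (2 * Real.pi * j / ((d : ℝ) - 1)) ∘ φ) :=
  mainTheorem6_general d hd V₂ V₁ f hf.isTopologicalPolynomialLike hK φ
    (hφs ▸ sdiff_subset_sdiff_left (subset_closure.trans hf.closure_subset))
    (hφt ▸ disjoint_sdiff_left) hφo hφ P χ B hχ hB
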